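/- For integers $r\ge 1$, $p\ge 1$ and $q\ge 1$ with $rq<p$, let $S_r(p,q)$ be the number of partitions of a $p$-element set into $q$ blocks, each of size at least $r$ (the $r$-associated Stirling number of the second kind). Put $$B_r(z)=e^z-\sum_{k=0}^{r-1}\frac{z^k}{k!},\qquad Q_r(z)=\frac{zB_r'(z)}{B_r(z)}.$$ The function $Q_r$ is a bijection from $(0,\infty)$ onto $(r,\infty)$; let $\xi_r=Q_r^{-1}\colon(r,\infty)\to(0,\infty)$ and $z_0=\xi_r(p/q)$. With $\Phi(z)=-p\ln z+q\ln B_r(z)$, the Hennecart approximation is $$F_r(p,q)=\frac{p!}{q!\,(p-rq)!}\left(\frac{p-rq}{e}\right)^{p-rq}\frac{B_r(z_0)^q}{z_0^{p+1}}\sqrt{\frac{p-rq}{\Phi''(z_0)}},$$ and the Connamacher–Dobrowolski approximation is $$C_r(p,q)=F_r(p,q)\,(p-rq)!\left(\sqrt{2\pi(p-rq)}\left(\frac{p-rq}{e}\right)^{p-rq}\right)^{-1}.$$ **Theorem.** Fix an integer $r\ge 1$. Over integers $p\ge 1$ and $1\le q<p/r$, as $qz_0\to\infty$, $$S_r(p,q)=C_r(p,q)\bigl(1+O((qz_0)^{-1})\bigr);$$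 that is, there are constants $K,M>0$ depending only on $r$ such that, for all such $p,q$ with $qz_0\ge M$, one has $S_r(p,q)=C_r(p,q)(1+\varepsilon)$ for some real $\varepsilon$ with $|\varepsilon|\le K(qz_0)^{-1}$. In particular, if $p-rq=\Omega(p^{\delta})$ for some $0<\delta<1$, then $$S_r(p,q)=C_r(p,q)\bigl(1+O(p^{-\delta})\bigr)\quad\text{and}\quad S_r(p,q)=F_r(p,q)\bigl(1+O(p^{-\delta})\bigr);$$ that is, for all $0<\delta<1$ and $c>0$ there is a constant $K>0$ depending only on $r,\delta,c$ such that, for all integers $p\ge1$ and $1\le q<p/r$ with $p-rq\ge c\,p^{\delta}$, one has $S_r(p,q)=C_r(p,q)(1+\varepsilon)$ and $S_r(p,q)=F_r(p,q)(1+\varepsilon')$ for some reals $\varepsilon,\varepsilon'$ with $|\varepsilon|,|\varepsilon'|\le Kp^{-\delta}$. -/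

import Mathlib

namespace AssocStirling

/-- The `r`-associated Stirling number of the second kind: the number of ways to partition a set of
size `p` into `q` blocks, each of size at least `r`. -/
noncomputable def S (r p q : ℕ) : ℕ :=
  Nat.card {P : Finpartition (Finset.univ : Finset (Fin p)) //
    P.parts.card = q ∧ ∀ s ∈ P.parts, r ≤ s.card}

/-- `B_r(z) = e^z - ∑_{k < r} z^k / k!`. -/
noncomputable def B (r : ℕ) (z : ℝ) : ℝ :=
  Real.exp z - ∑ k ∈ Finset.range r, z ^ k / (Nat.factorial k : ℝ)

/-- `Q_r(z) = z B_r'(z) / B_r(z)`. -/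
noncomputable def Q (r : ℕ) (z : ℝ) : ℝ :=
  z * deriv (B r) z / B r z

/-- `ξ_r`, the inverse of the restriction of `Q_r` to `(0, ∞)`. For `r ≥ 1` this restriction is a
bijection of `(0, ∞)` onto `(r, ∞)`, and only values of `ξ_r` on `(r, ∞)` are used. -/
noncomputable def xi (r : ℕ) (x : ℝ) : ℝ :=
  Function.invFunOn (Q r) (Set.Ioi 0) x

/-- The saddle point `z₀ = ξ_r(p / q)`. -/
noncomputable def z0 (r p q : ℕ) : ℝ :=
  xi r ((p : ℝ) / (q : ℝ))

/-- `Φ(z) = -p ln z + q ln B_r(z)`. -/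
noncomputable def Phi (r p q : ℕ) (z : ℝ) : ℝ :=
  -(p : ℝ) * Real.log z + (q : ℝ) * Real.log (B r z)

/-- The Hennecart approximation `F_r(p, q)`; here `q t₀ = p - r q`. It is used for `r q < p`
only, where the natural number `p - r * q` is the true difference. -/
noncomputable def F (r p q : ℕ) : ℝ :=
  (Nat.factorial p : ℝ) / ((Nat.factorial q : ℝ) * (Nat.factorial (p - r * q) : ℝ))
    * (((p : ℝ) - r * q) / Real.exp 1) ^ (p - r * q)
    * (B r (z0 r p q) ^ q / z0 r p q ^ (p + 1))
    * Real.sqrt (((p : ℝ) - r * q) / iteratedDeriv 2 (Phi r p q) (z0 r p q))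

/-- The Connamacher–Dobrowolski approximation `C_r(p, q)`: the Hennecart approximation times the
ratio of `(p - r q)!` to its Stirling approximation. -/
noncomputable def C (r p q : ℕ) : ℝ :=
  F r p q * (Nat.factorial (p - r * q) : ℝ)
    * (Real.sqrt (2 * Real.pi * ((p : ℝ) - r * q))
        * (((p : ℝ) - r * q) / Real.exp 1) ^ (p - r * q))⁻¹

end AssocStirling

/-! Since q! S_r(p,q) / p! is the coefficient of z^p in B_r(z)^q, integration over the circle of
radius x writes it as B_r(x)^q x^(-p) / (2π) times the integral over [-π, π] of f(θ) = (B_r(x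
e^{iθ}) / B_r(x))^q e^{-ipθ}. For x = z₀ the logarithmic derivative f'/f = iq (Q_r(x e^{iθ}) -
Q_r(x)) vanishes at θ = 0. Put V = q x Q_r'(x) and N = q x. By `C_eq`, C_r(p,q) is the value
obtained when the integral of f is replaced by √(2π/V), so it remains to prove that the integral is
√(2π/V) (1 + O(1/N)).

The difficulty is uniformity in x over (0, ∞). Dividing z^r out of B_r leaves `G`, an average of
exponentials against a probability density on [0,1]. This form gives the decay |f(θ)| ≤ exp(-cNθ²)
on the whole circle (`norm_charFn_le`) and Q_r(z) - r = O(x) on a complex disc of radius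
proportional to x (`exists_norm_Qc_sub_le`). Schwarz-type estimates then yield f'/f = -Vt + bt² +
O(N|t|³) near 0, with V and b of size O(N).

`exists_norm_integral_sub_le` turns these facts into the integral estimate. The first correction to
the Gaussian is an odd cubic and integrates to zero, so the relative error is 1/N and not 1/√N. The
lower bound V ≥ 2cN needs no separate study of Q_r': it is forced by the decay of f.

The polynomial error terms follow from p - rq ≤ q z₀ (`sub_le_mul_z0`), and Stirling's formula for
(p - rq)! passes from C_r to F_r. -/

namespace AssocStirling

open Finset

/-! ### Counting partitions through ordered block families -/

/-- The families of `q` pairwise disjoint sets of size at least `r` with union `s`. -/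
def families {α : Type*} [DecidableEq α] (r : ℕ) (s : Finset α) (q : ℕ) :
    Finset (Finset (Finset α)) :=
  {A ∈ s.powerset.powerset |
    #A = q ∧ (∀ t ∈ A, ∀ u ∈ A, t ≠ u → Disjoint t u) ∧ A.sup id = s ∧ ∀ t ∈ A, r ≤ #t}

theorem mem_families {α : Type*} [DecidableEq α] {r : ℕ} {s : Finset α} {q : ℕ}
    {A : Finset (Finset α)} :
    A ∈ families r s q ↔
      #A = q ∧ (∀ t ∈ A, ∀ u ∈ A, t ≠ u → Disjoint t u) ∧ A.sup id = s ∧ ∀ t ∈ A, r ≤ #t := by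
  simp only [families, mem_filter, mem_powerset, and_iff_right_iff_imp]
  rintro ⟨-, -, h, -⟩ t ht
  rw [mem_powerset, ← h]
  exact le_sup (f := id) ht

/-- Double counting of families with a distinguished block: erasing that block leaves a family on
its complement. Since r ≥ 1, blocks are nonempty, so the erased block cannot occur again among the
remaining ones. -/
theorem card_families_succ {α : Type*} [DecidableEq α] {r : ℕ} (hr : 1 ≤ r) (s : Finset α)
    (q : ℕ) :
    (q + 1) * #(families r s (q + 1)) =
      ∑ t ∈ s.powerset with r ≤ #t, #(families r (s \ t) q) := by
  rw [← card_sigma, mul_comm]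
  have h1 : #(families r s (q + 1)) * (q + 1) = #((families r s (q + 1)).sigma fun A => A) := by
    rw [card_sigma, sum_congr rfl (g := fun _ => q + 1), sum_const, smul_eq_mul]
    exact fun A hA => (mem_families.1 hA).1
  rw [h1]
  have key : ∀ (t : Finset α) (A : Finset (Finset α)), r ≤ #t → A ∈ families r (s \ t) q →
      ∀ u ∈ A, Disjoint u t := by
    intro t A _ hA u hu
    have h2 : u ≤ s \ t := by
      rw [← (mem_families.1 hA).2.2.1]
      exact le_sup (f := id) hu
    exact disjoint_of_subset_left h2 sdiff_disjoint
  have key2 : ∀ (t : Finset α) (A : Finset (Finset α)), r ≤ #t → A ∈ families r (s \ t) q →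
      t ∉ A := by
    intro t A ht hA htA
    have := key t A ht hA t htA
    rw [disjoint_self, bot_eq_empty] at this
    subst this
    simp at ht
    omega
  refine card_bij' (fun x _ => ⟨x.2, x.1.erase x.2⟩) (fun y _ => ⟨insert y.1 y.2, y.1⟩) ?_ ?_ ?_ ?_
  · rintro ⟨A, t⟩ h
    simp only [mem_sigma, mem_filter, mem_powerset] at h ⊢
    obtain ⟨hA, ht⟩ := h
    obtain ⟨hc, hd, hs, hb⟩ := mem_families.1 hA
    have hts : t ⊆ s := by rw [← hs]; exact le_sup (f := id) ht
    refine ⟨⟨hts, hb t ht⟩, mem_families.2 ⟨by rw [card_erase_of_mem ht, hc]; rfl, ?_, ?_, ?_⟩⟩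
    · exact fun u hu v hv => hd u (mem_of_mem_erase hu) v (mem_of_mem_erase hv)
    · apply le_antisymm
      · refine Finset.sup_le fun u hu => ?_
        have h3 : u ⊆ s := by
          rw [← hs]; exact le_sup (f := id) (mem_of_mem_erase hu)
        exact subset_sdiff.2 ⟨h3, hd u (mem_of_mem_erase hu) t ht (ne_of_mem_erase hu)⟩
      · intro a ha
        rw [mem_sdiff, ← hs, mem_sup] at ha
        obtain ⟨⟨u, hu, hau⟩, hat⟩ := ha
        rw [mem_sup]
        exact ⟨u, mem_erase.2 ⟨fun h => hat (h ▸ hau), hu⟩, hau⟩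
    · exact fun u hu => hb u (mem_of_mem_erase hu)
  · rintro ⟨t, A⟩ h
    simp only [mem_sigma, mem_filter, mem_powerset] at h ⊢
    obtain ⟨⟨hts, hrt⟩, hA⟩ := h
    have hdis := key t A hrt hA
    have hnot := key2 t A hrt hA
    obtain ⟨hc, hd, hs, hb⟩ := mem_families.1 hA
    refine ⟨mem_families.2 ⟨by rw [card_insert_of_notMem hnot, hc], ?_, ?_, ?_⟩,
      mem_insert_self _ _⟩
    · intro u hu v hv huv
      rw [mem_insert] at hu hv
      rcases hu with rfl | hu <;> rcases hv with rfl | hv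
      · exact absurd rfl huv
      · exact (hdis v hv).symm
      · exact hdis u hu
      · exact hd u hu v hv huv
    · rw [sup_insert, hs, id]
      exact union_sdiff_of_subset hts
    · intro u hu
      rw [mem_insert] at hu
      rcases hu with rfl | hu
      · exact hrt
      · exact hb u hu
  · rintro ⟨A, t⟩ h
    simp only [mem_sigma] at h
    simp [insert_erase h.2]
  · rintro ⟨t, A⟩ h
    simp only [mem_sigma, mem_filter, mem_powerset] at h
    simp [erase_insert (key2 t A h.1.2 h.2)]

/-- The number of maps from an `n`-element set to a `q`-element set all of whose fibres have at
least `r` elements. -/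
def fiberCount (r : ℕ) : ℕ → ℕ → ℕ
  | 0, n => if n = 0 then 1 else 0
  | q + 1, n => ∑ k ∈ range (n + 1), n.choose k • if r ≤ k then fiberCount r q (n - k) else 0

/-- The q! orders the blocks, so that a partition becomes a map to q labels. Peeling off one block
and grouping subsets by size gives the recursion of `fiberCount`. -/
theorem factorial_mul_card_families {α : Type*} [DecidableEq α] {r : ℕ} (hr : 1 ≤ r) (q : ℕ) :
    ∀ s : Finset α, q.factorial * #(families r s q) = fiberCount r q #s := by
  induction q with
  | zero =>
    intro s
    have : families r s 0 = if #s = 0 then {∅} else ∅ := by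
      ext A
      rw [mem_families]
      split_ifs with h
      · rw [card_eq_zero] at h
        subst h
        rw [mem_singleton, card_eq_zero]
        exact ⟨fun h => h.1, by rintro rfl; simp⟩
      · simp only [card_eq_zero, notMem_empty, iff_false]
        rintro ⟨rfl, -, h', -⟩
        exact h (by rw [← h']; simp)
    rw [this, fiberCount]
    split_ifs <;> simp
  | succ q ih =>
    intro s
    rw [Nat.factorial_succ, mul_comm (q + 1), mul_assoc, card_families_succ hr, mul_sum,
      fiberCount, sum_filter,
      ← sum_powerset_apply_card (fun k => if r ≤ k then fiberCount r q (#s - k) else 0)]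
    refine sum_congr rfl fun t ht => ?_
    rw [ih, card_sdiff_of_subset (mem_powerset.1 ht)]

theorem S_eq_card_families {r : ℕ} (hr : 1 ≤ r) (p q : ℕ) :
    S r p q = #(families r (univ : Finset (Fin p)) q) := by
  rw [S, ← Nat.card_eq_finsetCard]
  refine Nat.card_congr
    { toFun := fun P => ⟨P.1.parts, mem_families.2 ⟨P.2.1, ?_, P.1.sup_parts, P.2.2⟩⟩
      invFun := fun A => ⟨⟨A.1, ?_, (mem_families.1 A.2).2.2.1, ?_⟩, (mem_families.1 A.2).1,
        (mem_families.1 A.2).2.2.2⟩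
      left_inv := fun _ => rfl
      right_inv := fun _ => rfl }
  · exact fun t ht u hu htu => P.1.disjoint ht hu htu
  · rw [supIndep_iff_pairwiseDisjoint]
    exact fun t ht u hu htu => (mem_families.1 A.2).2.1 t ht u hu htu
  · intro h
    have := (mem_families.1 A.2).2.2.2 _ h
    simp at this
    omega

theorem factorial_mul_S {r : ℕ} (hr : 1 ≤ r) (p q : ℕ) :
    q.factorial * S r p q = fiberCount r q p := by
  rw [S_eq_card_families hr, factorial_mul_card_families hr, card_univ, Fintype.card_fin]

/-! ### The exponential generating function -/

/-- The complex extension of `B`. -/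
noncomputable def Bc (r : ℕ) (z : ℂ) : ℂ :=
  Complex.exp z - ∑ k ∈ range r, z ^ k / (k.factorial : ℂ)

theorem hasSum_Bc (r : ℕ) (z : ℂ) :
    HasSum (fun n : ℕ => if r ≤ n then z ^ n / (n.factorial : ℂ) else 0) (Bc r z) := by
  have h1 : HasSum (fun n : ℕ => z ^ n / (n.factorial : ℂ)) (Complex.exp z) := by
    rw [Complex.exp_eq_exp_ℂ]
    exact NormedSpace.expSeries_div_hasSum_exp z
  have h2 : HasSum (fun n : ℕ => if n ∈ range r then z ^ n / (n.factorial : ℂ) else 0)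
      (∑ k ∈ range r, z ^ k / (k.factorial : ℂ)) := by
    have := hasSum_sum_of_ne_finset_zero (L := SummationFilter.unconditional ℕ) (s := range r)
      (f := fun n : ℕ => if n ∈ range r then z ^ n / (n.factorial : ℂ) else 0)
      (fun b hb => if_neg hb)
    rwa [sum_congr rfl fun k hk => if_pos hk] at this
  rw [Bc]
  convert! h1.sub h2 using 1
  ext n
  by_cases h : r ≤ n
  · simp [h, not_lt.2 h]
  · simp [h, not_le.1 h]

/-- The recursion for `fiberCount` is a binomial convolution, hence a Cauchy product of exponential
series. Absolute summability is carried along because the Cauchy product needs it, as does the later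
termwise integration. -/
theorem hasSum_fiberCount (r q : ℕ) (z : ℂ) :
    (Summable fun n : ℕ => ‖(fiberCount r q n : ℂ) / (n.factorial : ℂ) * z ^ n‖) ∧
      HasSum (fun n : ℕ => (fiberCount r q n : ℂ) / (n.factorial : ℂ) * z ^ n) (Bc r z ^ q) := by
  induction q with
  | zero =>
    have h0 : ∀ n ∉ ({0} : Finset ℕ),
        (fiberCount r 0 n : ℂ) / (n.factorial : ℂ) * z ^ n = 0 := by
      intro n hn
      simp at hn
      simp [fiberCount, hn]
    constructor
    · exact summable_of_ne_finset_zero (s := {0}) fun n hn => by rw [h0 n hn, norm_zero]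
    · have := hasSum_sum_of_ne_finset_zero (L := SummationFilter.unconditional ℕ) h0
      simpa [fiberCount] using this
  | succ q ih =>
    have hB := hasSum_Bc r z
    have hBn : Summable fun n : ℕ => ‖if r ≤ n then z ^ n / (n.factorial : ℂ) else 0‖ :=
      hB.summable.norm
    have hcoef : ∀ n : ℕ, (fiberCount r (q + 1) n : ℂ) / (n.factorial : ℂ) * z ^ n =
        ∑ kl ∈ antidiagonal n, (if r ≤ kl.1 then z ^ kl.1 / (kl.1.factorial : ℂ) else 0) *
          ((fiberCount r q kl.2 : ℂ) / (kl.2.factorial : ℂ) * z ^ kl.2) := by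
      intro n
      rw [fiberCount, Nat.sum_antidiagonal_eq_sum_range_succ_mk, Nat.cast_sum, sum_div, sum_mul]
      refine sum_congr rfl fun k hk => ?_
      have hkn : k ≤ n := Nat.lt_succ_iff.1 (mem_range.1 hk)
      simp only
      split_ifs with h
      · rw [smul_eq_mul, Nat.cast_mul, Nat.cast_choose ℂ hkn]
        have h1 : (n.factorial : ℂ) ≠ 0 := by exact_mod_cast n.factorial_ne_zero
        have h2 : (k.factorial : ℂ) ≠ 0 := by exact_mod_cast k.factorial_ne_zero
        have h3 : ((n - k).factorial : ℂ) ≠ 0 := by exact_mod_cast (n - k).factorial_ne_zero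
        have h4 : z ^ n = z ^ k * z ^ (n - k) := by rw [← pow_add, Nat.add_sub_cancel' hkn]
        rw [h4]
        field_simp
      · simp
    have h6 := summable_norm_sum_mul_antidiagonal_of_summable_norm hBn ih.1
    refine ⟨h6.congr fun n => by rw [hcoef], ?_⟩
    rw [funext hcoef]
    have h5 := tsum_mul_tsum_eq_tsum_sum_antidiagonal_of_summable_norm hBn ih.1
    rw [hB.tsum_eq, ih.2.tsum_eq] at h5
    rw [pow_succ', h5]
    exact h6.of_norm.hasSum

end AssocStirling

/-! ### The normalised function `G`, with r = m + 1, and its decay on circles -/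

namespace AssocStirling

open Finset

/-- `G m z = ∫₀¹ (m + 1) s ^ m e^{(1 - s) z} ds`, which is `(m + 1)! B_{m+1}(z) / z ^ (m + 1)`. -/
noncomputable def G (m : ℕ) (z : ℂ) : ℂ :=
  ∫ s in (0 : ℝ)..1, ((m + 1) * s ^ m : ℝ) * Complex.exp ((1 - s : ℝ) * z)

/-- The restriction of `G` to the real line. -/
noncomputable def GR (m : ℕ) (x : ℝ) : ℝ :=
  ∫ s in (0 : ℝ)..1, ((m + 1) * s ^ m) * Real.exp ((1 - s) * x)

theorem G_ofReal (m : ℕ) (x : ℝ) : G m x = GR m x := by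
  rw [G, GR, ← intervalIntegral.integral_ofReal]
  congr 1
  ext s
  push_cast
  rfl

theorem mul_G_zero (z : ℂ) : z * G 0 z = Complex.exp z - 1 := by
  have h : ∀ s ∈ Set.uIcc (0 : ℝ) 1,
      HasDerivAt (fun s : ℝ => -Complex.exp ((1 - s : ℝ) * z))
        (z * (((0 : ℕ) + 1) * s ^ 0 * Complex.exp ((1 - s : ℝ) * z))) s := by
    intro s _
    have h1 : HasDerivAt (fun s : ℝ => ((1 - s : ℝ) : ℂ)) (-1 : ℂ) s := by
      have := (((hasDerivAt_id s).const_sub 1).ofReal_comp)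
      simpa using this
    have h2 := ((h1.mul_const z).cexp).neg
    convert! h2 using 1
    simp; ring
  have h3 := intervalIntegral.integral_eq_sub_of_hasDerivAt h
    (Continuous.intervalIntegrable (by fun_prop) _ _)
  rw [intervalIntegral.integral_const_mul] at h3
  rw [G]
  simp at h3 ⊢
  rw [h3]; ring

/-- Integration by parts with the primitive s^(m+1) e^{(1-s)z}. -/
theorem mul_G_succ (m : ℕ) (z : ℂ) : z * G (m + 1) z = (m + 2) * (G m z - 1) := by
  have h : ∀ s ∈ Set.uIcc (0 : ℝ) 1,
      HasDerivAt (fun s : ℝ => ((s ^ (m + 1) : ℝ) : ℂ) * Complex.exp ((1 - s : ℝ) * z))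
        (((m + 1) * s ^ m : ℝ) * Complex.exp ((1 - s : ℝ) * z) -
          z / (m + 2) * ((((m + 1 : ℕ) + 1) * s ^ (m + 1) : ℝ) * Complex.exp ((1 - s : ℝ) * z)))
        s := by
    intro s _
    have h1 : HasDerivAt (fun s : ℝ => ((1 - s : ℝ) : ℂ)) (-1 : ℂ) s := by
      have := (((hasDerivAt_id s).const_sub 1).ofReal_comp)
      simpa using this
    have h0 : HasDerivAt (fun s : ℝ => ((s ^ (m + 1) : ℝ) : ℂ)) (((m + 1) * s ^ m : ℝ) : ℂ) s := by
      have := (hasDerivAt_pow (m + 1) s).ofReal_comp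
      simpa using this
    have h2 := h0.mul ((h1.mul_const z).cexp)
    convert! h2 using 1
    have : (m + 2 : ℂ) ≠ 0 := by exact_mod_cast (by omega : m + 2 ≠ 0)
    push_cast
    field_simp
    ring
  have h3 := intervalIntegral.integral_eq_sub_of_hasDerivAt h
    (Continuous.intervalIntegrable (by fun_prop) _ _)
  rw [intervalIntegral.integral_sub (Continuous.intervalIntegrable (by fun_prop) _ _)
    (Continuous.intervalIntegrable (by fun_prop) _ _),
    intervalIntegral.integral_const_mul] at h3
  change G m z - z / (m + 2) * G (m + 1) z = _ at h3
  have h4 : (m + 2 : ℂ) ≠ 0 := by exact_mod_cast (by omega : m + 2 ≠ 0)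
  simp at h3
  field_simp at h3
  linear_combination -h3

/-- This is Taylor's remainder for exp in integral form; both sides obey the same recursion in m. -/
theorem pow_mul_G (m : ℕ) (z : ℂ) :
    z ^ (m + 1) * G m z = ((m + 1).factorial : ℂ) * Bc (m + 1) z := by
  induction m with
  | zero => simp [mul_G_zero, Bc]
  | succ m ih =>
    have h1 : z ^ (m + 1 + 1) * G (m + 1) z = (m + 2) * (z ^ (m + 1) * G m z - z ^ (m + 1)) := by
      rw [pow_succ, mul_assoc, mul_G_succ]; ring
    have h2 : Bc (m + 1 + 1) z = Bc (m + 1) z - z ^ (m + 1) / ((m + 1).factorial : ℂ) := by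
      rw [Bc, sum_range_succ, Bc]; ring
    have h3 : ((m + 1).factorial : ℂ) ≠ 0 := by exact_mod_cast (m + 1).factorial_ne_zero
    rw [h1, ih, h2, Nat.factorial_succ (m + 1)]
    push_cast
    field_simp
    ring

theorem integral_weight (m : ℕ) : ∫ s in (0 : ℝ)..1, ((m + 1) * s ^ m : ℝ) = 1 := by
  rw [intervalIntegral.integral_const_mul, integral_pow]
  have : (m + 1 : ℝ) ≠ 0 := by positivity
  simp [this]

theorem norm_G_le (m : ℕ) (z : ℂ) : ‖G m z‖ ≤ GR m z.re := by
  refine (intervalIntegral.norm_integral_le_integral_norm zero_le_one).trans_eq ?_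
  refine intervalIntegral.integral_congr fun s hs => ?_
  rw [Set.uIcc_of_le zero_le_one] at hs
  have : (0 : ℝ) ≤ (m + 1) * s ^ m := mul_nonneg (by positivity) (pow_nonneg hs.1 _)
  simp only [norm_mul, Complex.norm_exp, Complex.re_ofReal_mul, Complex.norm_real, Real.norm_eq_abs]
  rw [← abs_mul, abs_of_nonneg this]

theorem GR_mono (m : ℕ) : Monotone (GR m) := by
  intro x y hxy
  refine intervalIntegral.integral_mono_on zero_le_one
    (Continuous.intervalIntegrable (by fun_prop) _ _)
    (Continuous.intervalIntegrable (by fun_prop) _ _) fun s hs => ?_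
  have h1 := pow_nonneg hs.1 m
  have h2 : 0 ≤ 1 - s := by linarith [hs.2]
  gcongr

theorem GR_zero (m : ℕ) : GR m 0 = 1 := by
  have := integral_weight m
  simp only [GR, mul_zero, Real.exp_zero, mul_one, this]

theorem one_le_GR (m : ℕ) {x : ℝ} (hx : 0 ≤ x) : 1 ≤ GR m x :=
  (GR_zero m).symm.le.trans (GR_mono m hx)

theorem GR_le_exp (m : ℕ) {x y : ℝ} (hxy : x ≤ y) (hy : 0 ≤ y) : GR m x ≤ Real.exp y := by
  have : GR m x ≤ ∫ s in (0 : ℝ)..1, ((m + 1) * s ^ m) * Real.exp y := by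
    refine intervalIntegral.integral_mono_on zero_le_one
      (Continuous.intervalIntegrable (by fun_prop) _ _)
      (Continuous.intervalIntegrable (by fun_prop) _ _) fun s hs => ?_
    have h1 := pow_nonneg hs.1 m
    have h2 : 0 ≤ 1 - s := by linarith [hs.2]
    gcongr
    nlinarith [hs.1]
  rwa [intervalIntegral.integral_mul_const, integral_weight, one_mul] at this

/-- Under the density (m+1)s^m the mean of 1 - s is 1/(m+2). The exponential prefactor therefore
centres the variable, and the moment generating function of a centred variable increases on [0, ∞).
-/
theorem exp_mul_GR_le (m : ℕ) {x y : ℝ} (hx : 0 ≤ x) (hxy : x ≤ y) :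
    Real.exp (-(x / (m + 2))) * GR m x ≤ Real.exp (-(y / (m + 2))) * GR m y := by
  have hm : (m + 2 : ℝ) ≠ 0 := by positivity
  have e : ∀ u : ℝ, Real.exp (-(u / (m + 2))) * GR m u =
      ∫ s in (0 : ℝ)..1, ((m + 1) * s ^ m) * Real.exp ((1 - s - 1 / (m + 2)) * u) := by
    intro u
    rw [GR, ← intervalIntegral.integral_const_mul]
    congr 1
    ext s
    rw [mul_left_comm, ← Real.exp_add]
    congr 2
    ring
  have h0 : ∫ s in (0 : ℝ)..1, ((m + 1) * s ^ m) * ((1 - s - 1 / (m + 2)) * (y - x)) = 0 := by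
    have : ∀ s : ℝ, ((m + 1) * s ^ m) * ((1 - s - 1 / (m + 2)) * (y - x)) =
        (y - x) * ((1 - 1 / (m + 2)) * ((m + 1) * s ^ m) - (m + 1) * s ^ (m + 1)) := by
      intro s; ring
    simp_rw [this]
    rw [intervalIntegral.integral_const_mul,
      intervalIntegral.integral_sub (Continuous.intervalIntegrable (by fun_prop) _ _)
      (Continuous.intervalIntegrable (by fun_prop) _ _), intervalIntegral.integral_const_mul,
      integral_weight, intervalIntegral.integral_const_mul, integral_pow]
    push_cast
    field_simp
    simp
    ring_nf
    simp
  have hint : ∀ u : ℝ, IntervalIntegrable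
      (fun s : ℝ => ((m + 1) * s ^ m) * Real.exp ((1 - s - 1 / (m + 2)) * u))
      MeasureTheory.volume 0 1 := fun u => Continuous.intervalIntegrable (by fun_prop) _ _
  rw [e, e, ← sub_nonneg, ← intervalIntegral.integral_sub (hint y) (hint x)]
  refine h0.symm.le.trans ?_
  have hint0 : IntervalIntegrable
      (fun s : ℝ => ((m + 1) * s ^ m) * ((1 - s - 1 / (m + 2)) * (y - x)))
      MeasureTheory.volume 0 1 := Continuous.intervalIntegrable (by fun_prop) _ _
  refine intervalIntegral.integral_mono_on zero_le_one hint0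
    ((hint y).sub (hint x)) fun s hs => ?_
  have h1 : (0 : ℝ) ≤ (m + 1) * s ^ m := mul_nonneg (by positivity) (pow_nonneg hs.1 _)
  rw [← mul_sub]
  refine mul_le_mul_of_nonneg_left ?_ h1
  generalize 1 - s - 1 / ((m : ℝ) + 2) = t
  have h2 : Real.exp (t * y) = Real.exp (t * x) * Real.exp (t * (y - x)) := by
    rw [← Real.exp_add]; ring_nf
  have h3 := Real.add_one_le_exp (t * (y - x))
  have h4 := Real.exp_pos (t * x)
  rw [h2]
  -- For t ≥ 0 the factor e^{tx} is at least 1, for t ≤ 0 at most 1; both signs give the same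
  -- inequality, whose right side is at most e^{ty} - e^{tx}.
  have h5 : t * (y - x) ≤ Real.exp (t * x) * (t * (y - x)) := by
    rcases le_total 0 t with ht | ht
    · have := Real.one_le_exp (mul_nonneg ht hx)
      nlinarith [mul_nonneg ht (sub_nonneg.2 hxy)]
    · have := Real.exp_le_one_iff.2 (mul_nonpos_of_nonpos_of_nonneg ht hx)
      nlinarith [mul_nonneg (neg_nonneg.2 ht) (sub_nonneg.2 hxy)]
  nlinarith

/-- The loss of a factor 2 in the exponent pays for negative x: there `GR m x` is at most its value
at 0, and y - x ≤ 2y. -/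
theorem GR_le_of_abs_le (m : ℕ) {x y : ℝ} (h : |x| ≤ y) :
    GR m x ≤ GR m y * Real.exp (-((y - x) / (2 * (m + 2)))) := by
  obtain ⟨h1, h2⟩ := abs_le.1 h
  have hy : 0 ≤ y := (abs_nonneg x).trans h
  have key : ∀ u, 0 ≤ u → u ≤ y → GR m u ≤ GR m y * Real.exp (-((y - u) / (m + 2))) := by
    intro u hu huy
    have h3 := exp_mul_GR_le m hu huy
    have h4 : GR m u = Real.exp (u / (m + 2)) * (Real.exp (-(u / (m + 2))) * GR m u) := by
      rw [← mul_assoc, ← Real.exp_add]; simp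
    rw [h4]
    refine (mul_le_mul_of_nonneg_left h3 (Real.exp_pos _).le).trans_eq ?_
    rw [← mul_assoc, ← Real.exp_add, mul_comm]
    congr 2
    ring
  have hG := one_le_GR m hy
  have hm : (0 : ℝ) ≤ m := by positivity
  rcases le_total 0 x with hx | hx
  · refine (key x hx h2).trans (mul_le_mul_of_nonneg_left (Real.exp_le_exp.2 ?_) (by linarith))
    rw [neg_le_neg_iff, div_le_div_iff₀ (by positivity) (by positivity)]
    nlinarith
  · refine (GR_mono m hx).trans ((key 0 le_rfl hy).trans
      (mul_le_mul_of_nonneg_left (Real.exp_le_exp.2 ?_) (by linarith)))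
    rw [neg_le_neg_iff, div_le_div_iff₀ (by positivity) (by positivity)]
    nlinarith

/-- The norm is controlled by the real part x cos θ, and cos θ ≤ 1 - 2θ²/π² on [-π, π]. -/
theorem norm_G_circle_le (m : ℕ) {x θ : ℝ} (hx : 0 ≤ x) (hθ : |θ| ≤ Real.pi) :
    ‖G m (x * Complex.exp (θ * Complex.I))‖ ≤
      GR m x * Real.exp (-(1 / ((m + 2) * Real.pi ^ 2) * x * θ ^ 2)) := by
  have hre : (x * Complex.exp (θ * Complex.I)).re = x * Real.cos θ := by
    rw [Complex.re_ofReal_mul, Complex.exp_ofReal_mul_I_re]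
  have h1 := norm_G_le m (x * Complex.exp (θ * Complex.I))
  rw [hre] at h1
  have h2 : |x * Real.cos θ| ≤ x := by
    rw [abs_mul, abs_of_nonneg hx]
    exact mul_le_of_le_one_right hx (Real.abs_cos_le_one θ)
  refine h1.trans ((GR_le_of_abs_le m h2).trans ?_)
  have := one_le_GR m hx
  gcongr
  have h3 := Real.cos_le_one_sub_mul_cos_sq hθ
  have h4 : 1 / ((m + 2) * Real.pi ^ 2) * x * θ ^ 2 =
      x * (2 / Real.pi ^ 2 * θ ^ 2) / (2 * (m + 2)) := by field_simp
  rw [h4]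
  gcongr
  nlinarith

theorem norm_G_sub_le (m : ℕ) {x : ℝ} (hx : 0 ≤ x) {z : ℂ} (hz : ‖z - x‖ ≤ 1) :
    ‖G m z - G m x‖ ≤ 2 * Real.exp x * ‖z - x‖ := by
  rw [G, G, ← intervalIntegral.integral_sub (Continuous.intervalIntegrable (by fun_prop) _ _)
    (Continuous.intervalIntegrable (by fun_prop) _ _)]
  refine (intervalIntegral.norm_integral_le_integral_norm zero_le_one).trans ?_
  have : ∫ s in (0 : ℝ)..1, ((m + 1) * s ^ m) * (2 * Real.exp x * ‖z - x‖) =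
      2 * Real.exp x * ‖z - x‖ := by
    rw [intervalIntegral.integral_mul_const, integral_weight, one_mul]
  rw [← this]
  refine intervalIntegral.integral_mono_on zero_le_one
      (Continuous.intervalIntegrable (by fun_prop) _ _)
      (Continuous.intervalIntegrable (by fun_prop) _ _) fun s hs => ?_
  have h1 : (0 : ℝ) ≤ (m + 1) * s ^ m := mul_nonneg (by positivity) (pow_nonneg hs.1 _)
  rw [← mul_sub, norm_mul, Complex.norm_real, Real.norm_of_nonneg h1]
  refine mul_le_mul_of_nonneg_left ?_ h1
  have hs0 : 0 ≤ 1 - s := by linarith [hs.2]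
  have h2 : Complex.exp ((1 - s : ℝ) * z) - Complex.exp ((1 - s : ℝ) * x) =
      Complex.exp ((1 - s : ℝ) * x) * (Complex.exp ((1 - s : ℝ) * (z - x)) - 1) := by
    rw [mul_sub, mul_one, ← Complex.exp_add]; ring_nf
  have h3 : ‖((1 - s : ℝ) : ℂ) * (z - x)‖ ≤ ‖z - x‖ := by
    rw [norm_mul, Complex.norm_real, Real.norm_of_nonneg hs0]
    exact mul_le_of_le_one_left (norm_nonneg _) (by linarith [hs.1])
  have h4 := Complex.norm_exp_sub_one_le (h3.trans hz)
  rw [h2, norm_mul, Complex.norm_exp]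
  have h5 : (((1 - s : ℝ) : ℂ) * (x : ℂ)).re ≤ x := by
    rw [← Complex.ofReal_mul, Complex.ofReal_re]
    nlinarith [hs.1]
  calc _ ≤ Real.exp x * (2 * ‖z - x‖) := by
        gcongr
        exact h4.trans (by linarith)
    _ = _ := by ring

end AssocStirling

/-! ### An abstract local limit estimate -/

namespace AssocStirling

open Set

/-- Second-order comparison of a function solving `f' = h f`, with `h` close to `-V t + b t ^ 2`,
with the corrected Gaussian `e^{-V t ^ 2 / 2} (1 + b t ^ 3 / 3)`, up to the factor
`e^{V t ^ 2 / 2}`. -/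
theorem norm_mul_exp_sub_le {f h : ℝ → ℂ} {V N ρ C E : ℝ} {b : ℂ} (hN : 0 ≤ N) (hC : 0 ≤ C)
    (hρ1 : ρ ≤ 1) (f0 : f 0 = 1)
    (hf : ∀ t, |t| ≤ ρ → HasDerivAt f (h t * f t) t)
    (hh : ∀ t, |t| ≤ ρ → ‖h t + V * t - b * t ^ 2‖ ≤ C * N * |t| ^ 3)
    (hb : ‖b‖ ≤ C * N) {θ : ℝ} (hθ : |θ| ≤ ρ)
    (hE : ∀ t, |t| ≤ |θ| → ‖f t‖ * Real.exp (V / 2 * t ^ 2) ≤ E) :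
    ‖f θ * Real.exp (V / 2 * θ ^ 2) - 1‖ ≤ 2 * C * N * E * |θ| ^ 3 ∧
    ‖f θ * Real.exp (V / 2 * θ ^ 2) - 1 - b / 3 * θ ^ 3‖ ≤
      (2 * C ^ 2 * N ^ 2 * |θ| ^ 6 + C * N * |θ| ^ 4) * E := by
  -- Removing the Gaussian leaves u' = (h + Vt) u, whose coefficient is bt² up to O(N|t|³).
  set u : ℝ → ℂ := fun t => f t * Real.exp (V / 2 * t ^ 2) with hu
  have hE0 : 0 ≤ E := (by positivity : 0 ≤ ‖f 0‖ * Real.exp (V / 2 * 0 ^ 2)).trans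
    (hE 0 (by simp))
  have hu0 : u 0 = 1 := by simp [hu, f0]
  have hun : ∀ t, |t| ≤ |θ| → ‖u t‖ ≤ E := by
    intro t ht
    simp only [hu, norm_mul, Complex.norm_real, Real.norm_eq_abs, Real.abs_exp]
    exact hE t ht
  have hud : ∀ t, |t| ≤ |θ| → HasDerivAt u ((h t + V * t) * u t) t := by
    intro t ht
    have h1 : HasDerivAt (fun t : ℝ => ((Real.exp (V / 2 * t ^ 2) : ℝ) : ℂ))
        ((Real.exp (V / 2 * t ^ 2) * (V * t) : ℝ) : ℂ) t := by
      have h2 : HasDerivAt (fun t : ℝ => V / 2 * t ^ 2) (V * t) t := by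
        have := ((hasDerivAt_pow 2 t).const_mul (V / 2))
        convert! this using 1
        simp; ring
      exact h2.exp.ofReal_comp
    have h3 := (hf t (ht.trans hθ)).mul h1
    convert! h3 using 1
    simp only [hu]
    push_cast
    ring
  have mem : ∀ t s : ℝ, t ∈ Icc (-|s|) |s| ↔ |t| ≤ |s| := fun t s => by rw [mem_Icc, abs_le]
  have hg : ∀ t, |t| ≤ |θ| → ‖h t + V * t‖ ≤ 2 * C * N * |t| ^ 2 := by
    intro t ht
    have h1 : h t + V * t = (h t + V * t - b * t ^ 2) + b * t ^ 2 := by ring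
    have h2 : |t| ≤ 1 := ht.trans (hθ.trans hρ1)
    have h3 := abs_nonneg t
    rw [h1]
    refine (norm_add_le _ _).trans ?_
    rw [norm_mul, norm_pow, Complex.norm_real, Real.norm_eq_abs]
    have h4 : |t| ^ 3 ≤ |t| ^ 2 := pow_le_pow_of_le_one h3 h2 (by norm_num)
    have h5 := hh t (ht.trans hθ)
    have h6 : C * N * |t| ^ 3 ≤ C * N * |t| ^ 2 := by gcongr
    have h7 : ‖b‖ * |t| ^ 2 ≤ C * N * |t| ^ 2 := by gcongr
    linarith
  have first : ∀ s, |s| ≤ |θ| → ‖u s - 1‖ ≤ 2 * C * N * E * |s| ^ 3 := by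
    intro s hs
    have := (convex_Icc (-|s|) |s|).norm_image_sub_le_of_norm_hasDerivWithin_le (f := u)
      (f' := fun t => (h t + V * t) * u t) (C := 2 * C * N * |s| ^ 2 * E) (x := 0) (y := s)
      (fun t ht => (hud t (((mem t s).1 ht).trans hs)).hasDerivWithinAt)
      (fun t ht => ?_) ((mem 0 s).2 (by simp)) ((mem s s).2 le_rfl)
    · rw [hu0, sub_zero, Real.norm_eq_abs] at this
      exact this.trans_eq (by ring)
    · have ht' := (mem t s).1 ht
      rw [norm_mul]
      have h1 : ‖h t + V * t‖ ≤ 2 * C * N * |s| ^ 2 :=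
        (hg t (ht'.trans hs)).trans (by gcongr)
      exact mul_le_mul h1 (hun t (ht'.trans hs)) (norm_nonneg _) (by positivity)
  refine ⟨first θ le_rfl, ?_⟩
  -- Bootstrap: the derivative here splits into the cubic error times u and bt²(u - 1), and the
  -- latter is small by `first`.
  have hd : ∀ t : ℝ, |t| ≤ |θ| → HasDerivAt (fun t : ℝ => u t - 1 - b / 3 * t ^ 3)
      ((h t + V * t) * u t - b * t ^ 2) t := by
    intro t ht
    have h1 : HasDerivAt (fun t : ℝ => ((t ^ 3 : ℝ) : ℂ)) ((3 * t ^ 2 : ℝ) : ℂ) t := by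
      have := (hasDerivAt_pow 3 t).ofReal_comp
      simpa using this
    have h2 := ((hud t ht).sub_const 1).sub (h1.const_mul (b / 3))
    convert! h2 using 1
    · ext; simp
    · push_cast; ring
  have := (convex_Icc (-|θ|) |θ|).norm_image_sub_le_of_norm_hasDerivWithin_le
      (f := fun t : ℝ => u t - 1 - b / 3 * t ^ 3)
      (f' := fun t => (h t + V * t) * u t - b * t ^ 2)
      (C := (2 * C ^ 2 * N ^ 2 * |θ| ^ 5 + C * N * |θ| ^ 3) * E) (x := 0) (y := θ)
      (fun t ht => (hd t ((mem t θ).1 ht)).hasDerivWithinAt)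
      (fun t ht => ?_) ((mem 0 θ).2 (by simp)) ((mem θ θ).2 le_rfl)
  · simp only [hu0, sub_zero, Real.norm_eq_abs, sub_self] at this
    have h0 : ‖u θ - 1 - b / 3 * θ ^ 3 - (0 - b / 3 * ((0 : ℝ) : ℂ) ^ 3)‖ =
      ‖u θ - 1 - b / 3 * θ ^ 3‖ := by simp
    rw [h0] at this
    exact this.trans_eq (by ring)
  · have ht' := (mem t θ).1 ht
    have h1 : (h t + V * t) * u t - b * t ^ 2 =
        (h t + V * t - b * t ^ 2) * u t + b * t ^ 2 * (u t - 1) := by ring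
    rw [h1]
    refine (norm_add_le _ _).trans ?_
    rw [norm_mul _ (u t), norm_mul _ (u t - 1), norm_mul b, norm_pow, Complex.norm_real,
      Real.norm_eq_abs]
    have h2 : ‖h t + V * t - b * t ^ 2‖ * ‖u t‖ ≤ (C * N * |θ| ^ 3) * E :=
      mul_le_mul ((hh t (ht'.trans hθ)).trans (by gcongr)) (hun t ht') (norm_nonneg _)
        (by positivity)
    have h3 : ‖b‖ * |t| ^ 2 * ‖u t - 1‖ ≤ (C * N) * |θ| ^ 2 * (2 * C * N * E * |θ| ^ 3) := by
      have := (first t ht').trans (by gcongr : _ ≤ 2 * C * N * E * |θ| ^ 3)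
      gcongr
    nlinarith

/-- If V < 2cN, then |f| e^{Vt²/2} ≤ e^{-at²} with a > 0, while the comparison lemma keeps this
product within O(t³) of 1. These conflict as t → 0. -/
theorem two_mul_le_of_norm_le_exp {f h : ℝ → ℂ} {V N ρ C c : ℝ} {b : ℂ} (hN : 0 ≤ N) (hC : 0 ≤ C)
    (hρ : 0 < ρ) (hρ1 : ρ ≤ 1) (f0 : f 0 = 1)
    (hf : ∀ t, |t| ≤ ρ → HasDerivAt f (h t * f t) t)
    (hh : ∀ t, |t| ≤ ρ → ‖h t + V * t - b * t ^ 2‖ ≤ C * N * |t| ^ 3)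
    (hb : ‖b‖ ≤ C * N)
    (hfc : ∀ t, |t| ≤ ρ → ‖f t‖ ≤ Real.exp (-(c * N * t ^ 2))) :
    2 * c * N ≤ V := by
  by_contra! hV
  set a := c * N - V / 2 with ha
  have ha0 : 0 < a := by rw [ha]; linarith
  have hexp : ∀ t, |t| ≤ ρ → ‖f t‖ * Real.exp (V / 2 * t ^ 2) ≤ Real.exp (-(a * t ^ 2)) := by
    intro t ht
    refine (mul_le_mul_of_nonneg_right (hfc t ht) (Real.exp_pos _).le).trans_eq ?_
    rw [← Real.exp_add, ha]; ring_nf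
  set K := 2 * C * N with hK
  have hK0 : 0 ≤ K := by positivity
  have key : ∀ t, 0 < t → t ≤ ρ → a ≤ K * (1 + a) * t := by
    intro t ht htρ
    have habs : |t| = t := abs_of_pos ht
    have h1 := (norm_mul_exp_sub_le hN hC hρ1 f0 hf hh hb (habs.trans_le htρ) (E := 1)
      fun s hs => (hexp s (hs.trans (habs.trans_le htρ))).trans
        (Real.exp_le_one_iff.2 (by rw [neg_nonpos]; positivity))).1
    rw [habs, mul_one] at h1
    have h2 : 1 - K * t ^ 3 ≤ Real.exp (-(a * t ^ 2)) := by
      have h3 := norm_sub_norm_le (1 : ℂ) (f t * Real.exp (V / 2 * t ^ 2))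
      rw [norm_sub_rev, norm_one, norm_mul, Complex.norm_real, Real.norm_eq_abs,
        Real.abs_exp] at h3
      linarith [hexp t (habs.trans_le htρ)]
    have h4 : Real.exp (-(a * t ^ 2)) * (1 + a * t ^ 2) ≤ 1 := by
      have := Real.add_one_le_exp (a * t ^ 2)
      calc _ ≤ Real.exp (-(a * t ^ 2)) * Real.exp (a * t ^ 2) := by gcongr; linarith
        _ = 1 := by rw [← Real.exp_add]; simp
    have h5 : (1 - K * t ^ 3) * (1 + a * t ^ 2) ≤ 1 :=
      (mul_le_mul_of_nonneg_right h2 (by positivity)).trans h4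
    have h6 : a * t ^ 2 ≤ K * (1 + a) * t * t ^ 2 := by
      have h7 : t ^ 2 ≤ 1 := pow_le_one₀ ht.le (htρ.trans hρ1)
      have h8 : K * t ^ 3 * (a * t ^ 2) ≤ K * t ^ 3 * (a * 1) := by gcongr
      nlinarith
    exact le_of_mul_le_mul_right h6 (by positivity)
  -- A t small enough that K(1+a)t < a, contradicting `key`.
  have h9 := key (min ρ (a / (2 * (K * (1 + a) + 1)))) (by positivity) (min_le_left _ _)
  have h10 : K * (1 + a) * min ρ (a / (2 * (K * (1 + a) + 1))) ≤
      K * (1 + a) * (a / (2 * (K * (1 + a) + 1))) := by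
    gcongr; exact min_le_right _ _
  have h11 : K * (1 + a) * (a / (2 * (K * (1 + a) + 1))) < a := by
    rw [← mul_div_assoc, div_lt_iff₀ (by positivity)]
    have : 0 ≤ K * (1 + a) := by positivity
    nlinarith
  linarith

/-- Half of the exponential decay is spent on absorbing powers of y. -/
theorem pow_mul_exp_neg_le (k : ℕ) {y : ℝ} (hy : 0 ≤ y) :
    y ^ k * Real.exp (-(2 * y)) ≤ k.factorial * Real.exp (-y) := by
  have h := Real.pow_div_factorial_le_exp y hy k
  have hk : (0 : ℝ) < k.factorial := by exact_mod_cast k.factorial_pos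
  rw [div_le_iff₀ hk] at h
  calc _ ≤ Real.exp y * k.factorial * Real.exp (-(2 * y)) := by gcongr
    _ = k.factorial * (Real.exp y * Real.exp (-(2 * y))) := by ring
    _ = _ := by rw [← Real.exp_add]; ring_nf

end AssocStirling

namespace AssocStirling

open Set MeasureTheory

/-- A pointwise bound with integrable majorant. With y = cNt²/2, both N t⁴ and N² t⁶ are 1/N times a
power of y, which the Gaussian absorbs. -/
theorem norm_indicator_sub_le {f h : ℝ → ℂ} {V N ρ C c : ℝ} {b : ℂ} (hN : 1 ≤ N) (hC : 0 ≤ C)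
    (hρ : 0 < ρ) (hρ1 : ρ ≤ 1) (f0 : f 0 = 1) (hc : 0 < c)
    (hf : ∀ t, |t| ≤ ρ → HasDerivAt f (h t * f t) t)
    (hh : ∀ t, |t| ≤ ρ → ‖h t + V * t - b * t ^ 2‖ ≤ C * N * |t| ^ 3)
    (hb : ‖b‖ ≤ C * N) (hV : 2 * c * N ≤ V)
    (hfc : ∀ t, |t| ≤ Real.pi → ‖f t‖ ≤ Real.exp (-(c * N * t ^ 2))) (t : ℝ) :
    ‖(Ioc (-Real.pi) Real.pi).indicator f t -
        (Real.exp (-(V / 2) * t ^ 2) : ℝ) * (1 + b / 3 * t ^ 3)‖ ≤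
      (12 * C ^ 2 * (2 / c) ^ 3 + (2 + 4 / ρ ^ 4 + 2 / ρ) * (1 + C) * (2 / c) ^ 2) / N *
        Real.exp (-(c / 2 * N) * t ^ 2) := by
  have hN0 : 0 < N := by linarith
  set y := c * N * t ^ 2 / 2 with hy
  have hy0 : 0 ≤ y := by positivity
  have e1 : Real.exp (-(c / 2 * N) * t ^ 2) = Real.exp (-y) := by rw [hy]; ring_nf
  have e2 : Real.exp (-(c * N * t ^ 2)) = Real.exp (-(2 * y)) := by rw [hy]; ring_nf
  have p2 := pow_mul_exp_neg_le 2 hy0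
  have p3 := pow_mul_exp_neg_le 3 hy0
  norm_num [Nat.factorial] at p2 p3
  have q4 : N * |t| ^ 4 = (2 / c) ^ 2 * y ^ 2 / N := by
    rw [hy, Even.pow_abs (by decide)]; field_simp
  have q6 : N ^ 2 * |t| ^ 6 = (2 / c) ^ 3 * y ^ 3 / N := by
    rw [hy, Even.pow_abs (by decide)]; field_simp
  have r4 : N * |t| ^ 4 * Real.exp (-(2 * y)) ≤ 2 * (2 / c) ^ 2 / N * Real.exp (-y) := by
    rw [q4]
    calc _ = (2 / c) ^ 2 / N * (y ^ 2 * Real.exp (-(2 * y))) := by ring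
      _ ≤ (2 / c) ^ 2 / N * (2 * Real.exp (-y)) := by gcongr
      _ = _ := by ring
  have r6 : N ^ 2 * |t| ^ 6 * Real.exp (-(2 * y)) ≤ 6 * (2 / c) ^ 3 / N * Real.exp (-y) := by
    rw [q6]
    calc _ = (2 / c) ^ 3 / N * (y ^ 3 * Real.exp (-(2 * y))) := by ring
      _ ≤ (2 / c) ^ 3 / N * (6 * Real.exp (-y)) := by gcongr
      _ = _ := by ring
  have eV : Real.exp (-(V / 2) * t ^ 2) ≤ Real.exp (-(2 * y)) := by
    rw [← e2]
    apply Real.exp_le_exp.2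
    nlinarith [mul_le_mul_of_nonneg_right hV (sq_nonneg t)]
  have hpi : (1 : ℝ) < Real.pi := by linarith [Real.pi_gt_three]
  rw [e1]
  have hex := Real.exp_pos (-y)
  rcases le_or_gt |t| ρ with ht | ht
  · have hmem : t ∈ Ioc (-Real.pi) Real.pi := by
      have := abs_le.1 ht
      exact ⟨by linarith [this.1], by linarith [this.2]⟩
    rw [indicator_of_mem hmem]
    -- The choice of `E` is legitimate because V ≥ 2cN makes its exponent nondecreasing in |t|.
    have h1 := (norm_mul_exp_sub_le hN0.le hC hρ1 f0 hf hh hb ht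
      (E := Real.exp ((V / 2 - c * N) * t ^ 2)) fun s hs => ?_).2
    · have h2 : f t - (Real.exp (-(V / 2) * t ^ 2) : ℝ) * (1 + b / 3 * t ^ 3) =
          (Real.exp (-(V / 2) * t ^ 2) : ℝ) *
            (f t * Real.exp (V / 2 * t ^ 2) - 1 - b / 3 * t ^ 3) := by
        have : ((Real.exp (-(V / 2) * t ^ 2) : ℝ) : ℂ) * (Real.exp (V / 2 * t ^ 2) : ℝ) = 1 := by
          rw [← Complex.ofReal_mul, ← Real.exp_add]; simp
        linear_combination (-f t) * this
      rw [h2, norm_mul, Complex.norm_real, Real.norm_eq_abs, Real.abs_exp]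
      refine (mul_le_mul_of_nonneg_left h1 (Real.exp_pos _).le).trans ?_
      have h3 : Real.exp (-(V / 2) * t ^ 2) * ((2 * C ^ 2 * N ^ 2 * |t| ^ 6 + C * N * |t| ^ 4) *
          Real.exp ((V / 2 - c * N) * t ^ 2)) =
          2 * C ^ 2 * (N ^ 2 * |t| ^ 6 * Real.exp (-(2 * y))) +
            C * (N * |t| ^ 4 * Real.exp (-(2 * y))) := by
        rw [mul_left_comm, ← Real.exp_add, hy]; ring_nf
      rw [h3]
      calc _ ≤ 2 * C ^ 2 * (6 * (2 / c) ^ 3 / N * Real.exp (-y)) +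
            C * (2 * (2 / c) ^ 2 / N * Real.exp (-y)) := by gcongr
        _ = (12 * C ^ 2 * (2 / c) ^ 3 + 2 * C * (2 / c) ^ 2) / N * Real.exp (-y) := by ring
        _ ≤ _ := by
          gcongr ?_ / N * Real.exp (-y)
          have : 0 ≤ (4 / ρ ^ 4 + 2 / ρ) := by positivity
          gcongr <;> linarith
    · have hs1 : |s| ≤ Real.pi := by linarith
      refine (mul_le_mul_of_nonneg_right (hfc s hs1) (Real.exp_pos _).le).trans ?_
      rw [← Real.exp_add]
      apply Real.exp_le_exp.2
      have : s ^ 2 ≤ t ^ 2 := sq_le_sq.2 hs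
      nlinarith
  · have ht0 : 0 < |t| := hρ.trans ht
    -- Away from 0 there is no comparison of f with the Gaussian; both terms are bounded separately,
    -- and this inequality supplies the factor 1/N.
    have h1 : 1 ≤ N * |t| ^ 4 / ρ ^ 4 := by
      rw [one_le_div (by positivity)]
      have : ρ ^ 4 ≤ |t| ^ 4 := by gcongr
      nlinarith [pow_pos ht0 4]
    have h2 : ‖(Ioc (-Real.pi) Real.pi).indicator f t‖ ≤ Real.exp (-(2 * y)) := by
      by_cases hm : t ∈ Ioc (-Real.pi) Real.pi
      · rw [indicator_of_mem hm, ← e2]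
        exact hfc t (abs_le.2 ⟨hm.1.le, hm.2⟩)
      · rw [indicator_of_notMem hm, norm_zero]
        exact (Real.exp_pos _).le
    have h3 : ‖(Real.exp (-(V / 2) * t ^ 2) : ℝ) * (1 + b / 3 * t ^ 3)‖ ≤
        Real.exp (-(2 * y)) * (1 + C * (N * |t| ^ 4) / ρ) := by
      rw [norm_mul, Complex.norm_real, Real.norm_eq_abs, Real.abs_exp]
      have : ‖1 + b / 3 * (t : ℂ) ^ 3‖ ≤ 1 + C * (N * |t| ^ 4) / ρ := by
        refine (norm_add_le _ _).trans ?_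
        rw [norm_one, norm_mul, norm_div, norm_pow, Complex.norm_real, Real.norm_eq_abs]
        norm_num
        rw [le_div_iff₀ hρ]
        have h4 : ‖b‖ / 3 ≤ C * N := by linarith [norm_nonneg b]
        calc ‖b‖ / 3 * |t| ^ 3 * ρ ≤ C * N * |t| ^ 3 * |t| := by gcongr
          _ = _ := by ring
      gcongr
    refine (norm_sub_le _ _).trans ((add_le_add h2 h3).trans ?_)
    have hE := Real.exp_pos (-(2 * y))
    calc Real.exp (-(2 * y)) + Real.exp (-(2 * y)) * (1 + C * (N * |t| ^ 4) / ρ)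
        = Real.exp (-(2 * y)) * 2 * 1 + C / ρ * (N * |t| ^ 4 * Real.exp (-(2 * y))) := by ring
      _ ≤ Real.exp (-(2 * y)) * 2 * (N * |t| ^ 4 / ρ ^ 4) +
          C / ρ * (N * |t| ^ 4 * Real.exp (-(2 * y))) := by gcongr
      _ = (2 / ρ ^ 4 + C / ρ) * (N * |t| ^ 4 * Real.exp (-(2 * y))) := by ring
      _ ≤ (2 / ρ ^ 4 + C / ρ) * (2 * (2 / c) ^ 2 / N * Real.exp (-y)) := by gcongr
      _ = (4 / ρ ^ 4 + C * (2 / ρ)) * (2 / c) ^ 2 / N * Real.exp (-y) := by ring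
      _ ≤ _ := by
        gcongr ?_ / N * Real.exp (-y)
        have h5 : 0 ≤ 12 * C ^ 2 * (2 / c) ^ 3 := by positivity
        have h6 : (4 / ρ ^ 4 + C * (2 / ρ)) * (2 / c) ^ 2 ≤
            (2 + 4 / ρ ^ 4 + 2 / ρ) * (1 + C) * (2 / c) ^ 2 := by
          gcongr
          have h7 : 0 ≤ 4 / ρ ^ 4 := by positivity
          have h8 : 0 ≤ 2 / ρ := by positivity
          nlinarith [mul_nonneg hC h7]
        linarith

/-- The cubic term is odd, so it contributes nothing. -/
theorem integral_gaussian_mul_cubic {V : ℝ} (hV : 0 < V) (b : ℂ) :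
    Integrable (fun t : ℝ => ((Real.exp (-(V / 2) * t ^ 2) : ℝ) : ℂ) * (1 + b / 3 * (t : ℂ) ^ 3)) ∧
    ∫ t : ℝ, ((Real.exp (-(V / 2) * t ^ 2) : ℝ) : ℂ) * (1 + b / 3 * (t : ℂ) ^ 3) =
      ((√(2 * Real.pi / V) : ℝ) : ℂ) := by
  have h1 : Integrable (fun t : ℝ => ((Real.exp (-(V / 2) * t ^ 2) : ℝ) : ℂ)) :=
    (integrable_exp_neg_mul_sq (by positivity)).ofReal
  have h2 : Integrable (fun t : ℝ => b / 3 * ((t ^ 3 * Real.exp (-(V / 2) * t ^ 2) : ℝ) : ℂ)) := by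
    have := integrable_rpow_mul_exp_neg_mul_sq (b := V / 2) (by positivity) (s := 3) (by norm_num)
    have h3 : (fun x : ℝ => x ^ (3 : ℝ) * Real.exp (-(V / 2) * x ^ 2)) =
        fun x : ℝ => x ^ 3 * Real.exp (-(V / 2) * x ^ 2) := by
      ext x
      rw [← Real.rpow_natCast x 3]; norm_num
    rw [h3] at this
    exact this.ofReal.const_mul _
  have e : (fun t : ℝ => ((Real.exp (-(V / 2) * t ^ 2) : ℝ) : ℂ) * (1 + b / 3 * (t : ℂ) ^ 3)) =
      fun t : ℝ => ((Real.exp (-(V / 2) * t ^ 2) : ℝ) : ℂ) +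
        b / 3 * ((t ^ 3 * Real.exp (-(V / 2) * t ^ 2) : ℝ) : ℂ) := by
    ext t; push_cast; ring
  rw [e]
  refine ⟨h1.add h2, ?_⟩
  have h4 : ∫ t : ℝ, t ^ 3 * Real.exp (-(V / 2) * t ^ 2) = 0 := by
    have := integral_neg_eq_self (fun t : ℝ => t ^ 3 * Real.exp (-(V / 2) * t ^ 2)) volume
    have h5 : ∀ t : ℝ, (-t) ^ 3 * Real.exp (-(V / 2) * (-t) ^ 2) =
        -(t ^ 3 * Real.exp (-(V / 2) * t ^ 2)) := by intro t; ring_nf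
    simp_rw [h5] at this
    rw [integral_neg] at this
    linarith
  rw [integral_add h1 h2, integral_const_mul, integral_complex_ofReal, integral_complex_ofReal, h4,
    integral_gaussian]
  simp only [Complex.ofReal_zero, mul_zero, add_zero]
  congr 2
  field_simp

/-- **Local limit estimate**: a function on `[-π, π]` with Gaussian decay of rate `N` whose
logarithmic derivative is `-V t + b t ^ 2 + O(N t ^ 3)` near `0` has integral
`√(2 π / V) (1 + O(1 / N))`. -/
theorem exists_norm_integral_sub_le {C ρ c : ℝ} (hC : 0 ≤ C) (hρ : 0 < ρ) (hρ1 : ρ ≤ 1)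
    (hc : 0 < c) : ∃ K : ℝ, 0 < K ∧ ∀ (f h : ℝ → ℂ) (V N : ℝ) (b : ℂ), 0 < N → f 0 = 1 →
      Continuous f → (∀ t, |t| ≤ ρ → HasDerivAt f (h t * f t) t) →
      (∀ t, |t| ≤ ρ → ‖h t + V * t - b * t ^ 2‖ ≤ C * N * |t| ^ 3) →
      ‖b‖ ≤ C * N → V ≤ C * N →
      (∀ t, |t| ≤ Real.pi → ‖f t‖ ≤ Real.exp (-(c * N * t ^ 2))) →
      0 < V ∧ ‖(√(V / (2 * Real.pi)) : ℝ) * (∫ t in (-Real.pi)..Real.pi, f t) - 1‖ ≤ K / N := by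
  set K0 := 12 * C ^ 2 * (2 / c) ^ 3 + (2 + 4 / ρ ^ 4 + 2 / ρ) * (1 + C) * (2 / c) ^ 2 with hK0
  have hK0' : 0 ≤ K0 := by positivity
  refine ⟨K0 * √(C / c) + 2 * Real.pi * √C + 1, by positivity, ?_⟩
  intro f h V N b hN f0 hcont hf hh hb hVC hfc
  have hpi := Real.pi_pos
  have hpi1 : (1 : ℝ) < Real.pi := by linarith [Real.pi_gt_three]
  have hV2 : 2 * c * N ≤ V := two_mul_le_of_norm_le_exp hN.le hC hρ hρ1 f0 hf hh hb
    fun t ht => hfc t (by linarith)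
  have hV : 0 < V := lt_of_lt_of_le (by positivity) hV2
  refine ⟨hV, ?_⟩
  have hsq : √(V / (2 * Real.pi)) ≤ √(C * N) := by
    apply Real.sqrt_le_sqrt
    rw [div_le_iff₀ (by positivity)]
    have : 0 ≤ C * N := by positivity
    nlinarith
  -- For N < 1 a crude bound suffices, since the allowed error K/N exceeds K. The last two summands
  -- of the constant serve this case, the first serves N ≥ 1.
  rcases lt_or_ge N 1 with hN1 | hN1
  · have h1 : ‖∫ t in (-Real.pi)..Real.pi, f t‖ ≤ 1 * |Real.pi - -Real.pi| := by
      refine intervalIntegral.norm_integral_le_of_norm_le_const fun t ht => ?_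
      rw [uIoc_of_le (by linarith)] at ht
      exact (hfc t (abs_le.2 ⟨ht.1.le, ht.2⟩)).trans
        (Real.exp_le_one_iff.2 (by rw [neg_nonpos]; positivity))
    rw [abs_of_pos (by linarith)] at h1
    refine (norm_sub_le _ _).trans ?_
    rw [norm_mul, Complex.norm_real, Real.norm_of_nonneg (Real.sqrt_nonneg _), norm_one,
      le_div_iff₀ hN]
    have h2 : √(C * N) ≤ √C := Real.sqrt_le_sqrt (by nlinarith)
    have h3 : √(V / (2 * Real.pi)) * ‖∫ t in (-Real.pi)..Real.pi, f t‖ ≤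
        √C * (2 * Real.pi) := by
      apply mul_le_mul (hsq.trans h2) (by linarith) (norm_nonneg _) (Real.sqrt_nonneg _)
    have h4 : 0 ≤ K0 * √(C / c) := by positivity
    have h5 : 0 ≤ √(V / (2 * Real.pi)) * ‖∫ t in (-Real.pi)..Real.pi, f t‖ := by positivity
    nlinarith
  · obtain ⟨hi, hg⟩ := integral_gaussian_mul_cubic hV b
    have hF : Integrable ((Ioc (-Real.pi) Real.pi).indicator f) := by
      rw [integrable_indicator_iff measurableSet_Ioc]
      exact (hcont.intervalIntegrable (-Real.pi) Real.pi).1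
    have h1 : (∫ t in (-Real.pi)..Real.pi, f t) - (√(2 * Real.pi / V) : ℝ) =
        ∫ t : ℝ, ((Ioc (-Real.pi) Real.pi).indicator f t -
          (Real.exp (-(V / 2) * t ^ 2) : ℝ) * (1 + b / 3 * t ^ 3)) := by
      rw [integral_sub hF hi, hg, integral_indicator measurableSet_Ioc,
        intervalIntegral.integral_of_le (by linarith)]
    have h2 : ‖(∫ t in (-Real.pi)..Real.pi, f t) - (√(2 * Real.pi / V) : ℝ)‖ ≤
        K0 / N * √(Real.pi / (c / 2 * N)) := by
      rw [h1, ← integral_gaussian, ← integral_const_mul]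
      refine norm_integral_le_of_norm_le
        ((integrable_exp_neg_mul_sq (by positivity)).const_mul _) ?_
      exact Filter.Eventually.of_forall fun t =>
        norm_indicator_sub_le hN1 hC hρ hρ1 f0 hc hf hh hb hV2 hfc t
    have h3 : ((√(V / (2 * Real.pi)) : ℝ) : ℂ) * (√(2 * Real.pi / V) : ℝ) = 1 := by
      rw [← Complex.ofReal_mul, ← Real.sqrt_mul (by positivity)]
      have : V / (2 * Real.pi) * (2 * Real.pi / V) = 1 := by field_simp
      rw [this]; simp
    rw [← h3, ← mul_sub, norm_mul, Complex.norm_real, Real.norm_of_nonneg (Real.sqrt_nonneg _)]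
    have h4 : √(V / (2 * Real.pi)) * √(Real.pi / (c / 2 * N)) ≤ √(C / c) := by
      rw [← Real.sqrt_mul (by positivity)]
      apply Real.sqrt_le_sqrt
      have : V / (2 * Real.pi) * (Real.pi / (c / 2 * N)) = V / N / c := by field_simp
      rw [this]
      gcongr
      rwa [div_le_iff₀ hN]
    calc _ ≤ √(V / (2 * Real.pi)) * (K0 / N * √(Real.pi / (c / 2 * N))) := by gcongr
      _ = K0 / N * (√(V / (2 * Real.pi)) * √(Real.pi / (c / 2 * N))) := by ring
      _ ≤ K0 / N * √(C / c) := by gcongr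
      _ = K0 * √(C / c) / N := by ring
      _ ≤ _ := by
        gcongr
        have : 0 ≤ 2 * Real.pi * √C := by positivity
        linarith

end AssocStirling

/-! ### Uniform bounds for `G` and `Qc` near the positive axis -/

namespace AssocStirling

open Finset

/-- Every term is at most (2x)^(m+1), whereas exp(x/2) contains (x/2)^(m+2)/(m+2)!; the threshold on
x comes from comparing the two. -/
theorem sum_pow_div_factorial_le_exp (m : ℕ) {x : ℝ} (hx1 : 1 ≤ x)
    (hx : (m + 2) * 2 ^ (m + 1) * 2 ^ (m + 2) * ((m + 2).factorial : ℝ) ≤ x) :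
    ∑ k ∈ range (m + 2), (2 * x) ^ k / (k.factorial : ℝ) ≤ Real.exp (x / 2) := by
  have h1 : ∑ k ∈ range (m + 2), (2 * x) ^ k / (k.factorial : ℝ) ≤
      ∑ k ∈ range (m + 2), (2 * x) ^ (m + 1) := by
    refine sum_le_sum fun k hk => ?_
    have hk1 : (1 : ℝ) ≤ k.factorial := by exact_mod_cast k.factorial_pos
    refine (div_le_self (by positivity) hk1).trans ?_
    exact pow_le_pow_right₀ (by linarith) (Nat.lt_succ_iff.1 (mem_range.1 hk))
  rw [sum_const, card_range, nsmul_eq_mul] at h1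
  have h2 := Real.pow_div_factorial_le_exp (x / 2) (by positivity) (m + 2)
  refine h1.trans (le_trans ?_ h2)
  have hf : (0 : ℝ) < (m + 2).factorial := by exact_mod_cast (m + 2).factorial_pos
  rw [le_div_iff₀ hf, div_pow, le_div_iff₀ (by positivity), mul_pow, pow_succ x (m + 1)]
  push_cast
  have h3 : (0 : ℝ) ≤ x ^ (m + 1) := by positivity
  nlinarith [mul_le_mul_of_nonneg_left hx h3]

theorem one_le_norm_G (m : ℕ) {x : ℝ} (hx1 : 1 ≤ x)
    (hx : (m + 2) * 2 ^ (m + 1) * 2 ^ (m + 2) * ((m + 2).factorial : ℝ) ≤ x) {z : ℂ}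
    (hz : ‖z - x‖ ≤ x / 2) : 1 ≤ ‖G m z‖ := by
  have hre : x / 2 ≤ z.re := by
    have h := (Complex.abs_re_le_norm (z - x)).trans hz
    rw [Complex.sub_re, Complex.ofReal_re, abs_le] at h
    linarith [h.1]
  have hnz : ‖z‖ ≤ 2 * x := by
    have h := norm_add_le (z - x) x
    rw [sub_add_cancel, Complex.norm_real, Real.norm_of_nonneg (by linarith)] at h
    linarith
  have hz0 : 0 < ‖z‖ := by
    have := (Complex.abs_re_le_norm z)
    have := le_abs_self z.re
    linarith
  have hs := sum_pow_div_factorial_le_exp m hx1 hx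
  -- The term k = m+1 is not part of `Bc (m + 1)`; it is the surplus that bounds (m+1)! |B| below by
  -- (2x)^(m+1) ≥ |z|^(m+1).
  rw [sum_range_succ] at hs
  have h1 : Real.exp (x / 2) - ∑ k ∈ range (m + 1), (2 * x) ^ k / (k.factorial : ℝ) ≤
      ‖Bc (m + 1) z‖ := by
    rw [Bc]
    refine le_trans ?_ (norm_sub_norm_le _ _)
    refine sub_le_sub ?_ ?_
    · rw [Complex.norm_exp]
      exact Real.exp_le_exp.2 hre
    · refine (norm_sum_le _ _).trans (sum_le_sum fun k _ => ?_)
      rw [norm_div, norm_pow, Complex.norm_natCast]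
      gcongr
  have hf : (0 : ℝ) < (m + 1).factorial := by exact_mod_cast (m + 1).factorial_pos
  have h2 : (2 * x) ^ (m + 1) ≤ (m + 1).factorial * ‖Bc (m + 1) z‖ := by
    rw [← div_le_iff₀' hf]
    linarith
  have h3 := congrArg norm (pow_mul_G m z)
  rw [norm_mul, norm_mul, norm_pow, Complex.norm_natCast] at h3
  rw [← h3] at h2
  have h4 : ‖z‖ ^ (m + 1) ≤ (2 * x) ^ (m + 1) := by gcongr
  exact le_of_mul_le_mul_left (by linarith) (pow_pos hz0 (m + 1))

/-- For x ≥ R the exponential dominates. For x ≤ R, G ≥ 1 on the axis, and the second term in η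
keeps the Lipschitz variation 2e^R |z - x| below 1/2. -/
theorem exists_half_le_norm_G (m : ℕ) : ∃ η : ℝ, 0 < η ∧ η ≤ 1 / 2 ∧
    ∀ x : ℝ, 0 < x → ∀ z : ℂ, ‖z - x‖ ≤ η * x → 1 / 2 ≤ ‖G m z‖ := by
  set R : ℝ := (m + 2) * 2 ^ (m + 1) * 2 ^ (m + 2) * ((m + 2).factorial : ℝ) + 1 with hR
  have hR1 : 1 ≤ R := by
    have : 0 ≤ (m + 2) * 2 ^ (m + 1) * 2 ^ (m + 2) * ((m + 2).factorial : ℝ) := by positivity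
    linarith
  refine ⟨min (1 / 2) (1 / (4 * R * Real.exp R)), by positivity, min_le_left _ _, ?_⟩
  intro x hx z hz
  rcases le_total R x with h | h
  · have h1 : ‖z - x‖ ≤ x / 2 := by
      refine hz.trans ?_
      have := mul_le_mul_of_nonneg_right (min_le_left (1 / 2) (1 / (4 * R * Real.exp R))) hx.le
      linarith
    have := one_le_norm_G m (hR1.trans h) (by linarith) h1
    linarith
  · have h1 : ‖z - x‖ ≤ 1 / (4 * Real.exp R) := by
      refine hz.trans ((mul_le_mul (min_le_right _ _) h hx.le (by positivity)).trans_eq ?_)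
      field_simp
    have h2 : 1 / (4 * Real.exp R) ≤ 1 := by
      rw [div_le_one (by positivity)]
      linarith [Real.one_le_exp (by linarith : 0 ≤ R)]
    have h3 := norm_G_sub_le m hx.le (h1.trans h2)
    have h4 : 2 * Real.exp x * ‖z - x‖ ≤ 2 * Real.exp R * (1 / (4 * Real.exp R)) := by gcongr
    have h5 : 2 * Real.exp R * (1 / (4 * Real.exp R)) = 1 / 2 := by field_simp; norm_num
    have h6 := norm_sub_norm_le (G m x) (G m z)
    rw [norm_sub_rev, G_ofReal, Complex.norm_real, Real.norm_eq_abs] at h6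
    have h7 := (one_le_GR m hx.le).trans (le_abs_self _)
    rw [G_ofReal] at h3
    linarith

/-- The complex extension of `Q (m + 1)`. -/
noncomputable def Qc (m : ℕ) (z : ℂ) : ℂ := z + (m + 1) / G m z

/-- The bound linear in x is what makes N = qx the natural scale for all x. For x ≥ 1 boundedness of
1/G is enough; for x ≤ 1 one uses G - 1 = z G_{m+1} / (m+2). -/
theorem exists_norm_Qc_sub_le (m : ℕ) : ∃ η C : ℝ, 0 < η ∧ η ≤ 1 / 2 ∧ 0 < C ∧
    ∀ x : ℝ, 0 < x → ∀ z : ℂ, ‖z - x‖ ≤ η * x → G m z ≠ 0 ∧ ‖Qc m z - (m + 1)‖ ≤ C * x := by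
  obtain ⟨η, hη, hη2, hG⟩ := exists_half_le_norm_G m
  refine ⟨η, 2 + (m + 1) * (4 * Real.exp 2 + 3), hη, hη2, by positivity, fun x hx z hz => ?_⟩
  have h1 := hG x hx z hz
  have h0 : G m z ≠ 0 := by
    rw [← norm_pos_iff]; linarith
  refine ⟨h0, ?_⟩
  have hnz : ‖z‖ ≤ 2 * x := by
    have h := norm_add_le (z - x) x
    rw [sub_add_cancel, Complex.norm_real, Real.norm_of_nonneg hx.le] at h
    nlinarith
  have hm : (0 : ℝ) ≤ m := by positivity
  have key : ‖1 / G m z - 1‖ ≤ (4 * Real.exp 2 + 3) * x := by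
    have hinv : ‖1 / G m z‖ ≤ 2 := by
      rw [norm_div, norm_one, div_le_iff₀ (by linarith)]; linarith
    have he : 0 < Real.exp 2 := Real.exp_pos 2
    rcases le_total 1 x with h | h
    · have := norm_sub_le (1 / G m z) 1
      rw [norm_one] at this
      nlinarith
    · have h2 : 1 / G m z - 1 = -((G m z - 1) * (1 / G m z)) := by field_simp; ring
      have h3 := congrArg norm (mul_G_succ m z)
      rw [norm_mul, norm_mul] at h3
      have h4 : ‖(m + 2 : ℂ)‖ = m + 2 := by
        rw [show (m + 2 : ℂ) = ((m + 2 : ℕ) : ℂ) by push_cast; ring, Complex.norm_natCast]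
        push_cast; ring
      rw [h4] at h3
      have h5 : ‖G (m + 1) z‖ ≤ Real.exp 2 := by
        refine (norm_G_le _ _).trans (GR_le_exp _ ?_ (by norm_num))
        have := (le_abs_self z.re).trans (Complex.abs_re_le_norm z)
        linarith
      have h6 : ‖z‖ * ‖G (m + 1) z‖ ≤ 2 * x * Real.exp 2 := by gcongr
      have h7 : ‖G m z - 1‖ ≤ 2 * x * Real.exp 2 := by
        nlinarith [norm_nonneg (G m z - 1)]
      rw [h2, norm_neg, norm_mul]
      calc _ ≤ 2 * x * Real.exp 2 * 2 := by gcongr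
        _ ≤ _ := by nlinarith
  have h8 : Qc m z - (m + 1) = z + (m + 1) * (1 / G m z - 1) := by rw [Qc]; ring
  have h9 : ‖(m + 1 : ℂ)‖ = m + 1 := by
    rw [show (m + 1 : ℂ) = ((m + 1 : ℕ) : ℂ) by push_cast; ring, Complex.norm_natCast]
    push_cast; ring
  rw [h8]
  refine (norm_add_le _ _).trans ?_
  rw [norm_mul, h9]
  have := mul_le_mul_of_nonneg_left key (by linarith : 0 ≤ (m : ℝ) + 1)
  linarith

theorem hasDerivAt_Bc (m : ℕ) (z : ℂ) :
    HasDerivAt (Bc (m + 1)) (Bc (m + 1) z + z ^ m / (m.factorial : ℂ)) z := by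
  induction m with
  | zero =>
    have := (Complex.hasDerivAt_exp z).sub_const 1
    convert! this using 1
    · ext; simp [Bc]
    · simp [Bc]
  | succ m ih =>
    have e : Bc (m + 1 + 1) = fun z => Bc (m + 1) z - z ^ (m + 1) / ((m + 1).factorial : ℂ) := by
      ext w
      rw [Bc, sum_range_succ, Bc]; ring
    have h := ih.sub ((hasDerivAt_pow (m + 1) z).div_const ((m + 1).factorial : ℂ))
    rw [e]
    convert! h using 1
    rw [Nat.factorial_succ]
    have h1 : (m.factorial : ℂ) ≠ 0 := by exact_mod_cast m.factorial_ne_zero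
    have h2 : (m + 1 : ℂ) ≠ 0 := by exact_mod_cast (by omega : m + 1 ≠ 0)
    push_cast
    field_simp
    simp
    ring

theorem G_eq_div (m : ℕ) {z : ℂ} (hz : z ≠ 0) :
    G m z = ((m + 1).factorial : ℂ) * Bc (m + 1) z / z ^ (m + 1) := by
  rw [← pow_mul_G, mul_div_cancel_left₀ _ (pow_ne_zero _ hz)]

theorem differentiableAt_G (m : ℕ) {z : ℂ} (hz : z ≠ 0) : DifferentiableAt ℂ (G m) z := by
  have h1 : DifferentiableAt ℂ
      (fun z => ((m + 1).factorial : ℂ) * Bc (m + 1) z / z ^ (m + 1)) z :=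
    ((hasDerivAt_Bc m z).differentiableAt.const_mul _).div (by fun_prop) (pow_ne_zero _ hz)
  refine h1.congr_of_eventuallyEq ?_
  filter_upwards [isOpen_ne.mem_nhds hz] with w hw using G_eq_div m hw

theorem Bc_ne_zero {m : ℕ} {z : ℂ} (hz : z ≠ 0) (hG : G m z ≠ 0) : Bc (m + 1) z ≠ 0 := by
  intro h
  have := pow_mul_G m z
  rw [h, mul_zero] at this
  exact mul_ne_zero (pow_ne_zero _ hz) hG this

theorem Qc_eq_div {m : ℕ} {z : ℂ} (hz : z ≠ 0) (hG : G m z ≠ 0) :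
    Qc m z = z * (Bc (m + 1) z + z ^ m / (m.factorial : ℂ)) / Bc (m + 1) z := by
  have h1 : (m.factorial : ℂ) ≠ 0 := by exact_mod_cast m.factorial_ne_zero
  have h2 : (m + 1 : ℂ) ≠ 0 := by exact_mod_cast (by omega : m + 1 ≠ 0)
  have h3 := Bc_ne_zero hz hG
  rw [Qc, G_eq_div m hz, Nat.factorial_succ]
  push_cast
  field_simp
  ring

theorem differentiableAt_Qc {m : ℕ} {z : ℂ} (hz : z ≠ 0) (hG : G m z ≠ 0) :
    DifferentiableAt ℂ (Qc m) z :=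
  differentiableAt_id.add ((differentiableAt_const _).div (differentiableAt_G m hz) hG)

end AssocStirling

/-! ### The characteristic function and its integral at the saddle point -/

namespace AssocStirling

open Metric

/-- The Schwarz lemma is applied to three successive difference quotients at 0. Each step divides by
R, and subtracting the value at 0 costs a factor 2 from the second step on. -/
theorem exists_norm_taylor_two_le {F : ℂ → ℂ} {R M : ℝ} (hR : 0 < R)
    (hd : DifferentiableOn ℂ F (ball 0 R)) (h0 : F 0 = 0) (hM : ∀ z ∈ ball (0 : ℂ) R, ‖F z‖ ≤ M) :
    ‖deriv F 0‖ ≤ M / R ∧ ∃ b : ℂ, ‖b‖ ≤ 2 * M / R ^ 2 ∧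
      ∀ z ∈ ball (0 : ℂ) R, ‖F z - deriv F 0 * z - b * z ^ 2‖ ≤ 4 * M / R ^ 3 * ‖z‖ ^ 3 := by
  have step : ∀ (f : ℂ → ℂ) (L : ℝ), DifferentiableOn ℂ f (ball 0 R) →
      (∀ z ∈ ball (0 : ℂ) R, ‖f z - f 0‖ ≤ L) →
      DifferentiableOn ℂ (dslope f 0) (ball 0 R) ∧
      (∀ z ∈ ball (0 : ℂ) R, ‖dslope f 0 z‖ ≤ L / R) ∧
      ∀ z, f z = f 0 + z * dslope f 0 z := by
    intro f L hf hL
    refine ⟨(Complex.differentiableOn_dslope (ball_mem_nhds 0 hR)).2 hf, fun z hz => ?_,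
      fun z => ?_⟩
    · exact Complex.norm_dslope_le_div_of_mapsTo_ball hf
        (fun w hw => by rw [mem_closedBall, dist_eq_norm]; exact hL w hw) hz
    · have := sub_smul_dslope f 0 z
      rw [sub_zero, smul_eq_mul] at this
      rw [this]; ring
  have h00 : (0 : ℂ) ∈ ball (0 : ℂ) R := mem_ball_self hR
  have two : ∀ (f : ℂ → ℂ) (L : ℝ), (∀ z ∈ ball (0 : ℂ) R, ‖f z‖ ≤ L) →
      ∀ z ∈ ball (0 : ℂ) R, ‖f z - f 0‖ ≤ 2 * L := fun f L h z hz =>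
    (norm_sub_le _ _).trans (by linarith [h z hz, h 0 h00])
  obtain ⟨d1, b1, e1⟩ := step F M hd (fun z hz => by rw [h0, sub_zero]; exact hM z hz)
  obtain ⟨d2, b2, e2⟩ := step _ _ d1 (two _ _ b1)
  obtain ⟨-, b3, e3⟩ := step _ _ d2 (two _ _ b2)
  rw [← dslope_same F 0]
  refine ⟨b1 0 h00, dslope (dslope F 0) 0 0, (b2 0 h00).trans_eq (by ring), fun z hz => ?_⟩
  have h1 : F z - dslope F 0 0 * z - dslope (dslope F 0) 0 0 * z ^ 2 =
      dslope (dslope (dslope F 0) 0) 0 z * z ^ 3 := by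
    have := e1 z
    rw [e2 z, e3 z, h0] at this
    rw [this]; ring
  rw [h1, norm_mul, norm_pow]
  refine mul_le_mul_of_nonneg_right ((b3 z hz).trans_eq ?_) (by positivity)
  ring

theorem Bc_ofReal (r : ℕ) (x : ℝ) : Bc r x = B r x := by
  simp [Bc, B]

theorem hasDerivAt_B (m : ℕ) (x : ℝ) :
    HasDerivAt (B (m + 1)) (B (m + 1) x + x ^ m / (m.factorial : ℝ)) x := by
  have h := (hasDerivAt_Bc m x).real_of_complex
  have e : (fun y : ℝ => (Bc (m + 1) y).re) = B (m + 1) := by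
    ext y; rw [Bc_ofReal, Complex.ofReal_re]
  rw [e] at h
  convert! h using 1
  rw [Bc_ofReal, ← Complex.ofReal_natCast, ← Complex.ofReal_pow, ← Complex.ofReal_div,
    ← Complex.ofReal_add, Complex.ofReal_re]

theorem G_ofReal_ne_zero (m : ℕ) {x : ℝ} (hx : 0 ≤ x) : G m x ≠ 0 := by
  rw [G_ofReal, Ne, Complex.ofReal_eq_zero]
  linarith [one_le_GR m hx]

theorem B_pos (m : ℕ) {x : ℝ} (hx : 0 < x) : 0 < B (m + 1) x := by
  have h := pow_mul_G m x
  rw [G_ofReal, Bc_ofReal] at h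
  have h1 : x ^ (m + 1) * GR m x = ((m + 1).factorial : ℝ) * B (m + 1) x := by exact_mod_cast h
  have h2 : 0 < x ^ (m + 1) * GR m x :=
    mul_pos (pow_pos hx _) (by linarith [one_le_GR m hx.le])
  rw [h1] at h2
  exact pos_of_mul_pos_right h2 (by positivity)

theorem Q_ofReal (m : ℕ) {x : ℝ} (hx : 0 < x) : (Q (m + 1) x : ℂ) = Qc m x := by
  rw [Qc_eq_div (by exact_mod_cast hx.ne') (G_ofReal_ne_zero m hx.le), Q,
    (hasDerivAt_B m x).deriv, Bc_ofReal]
  push_cast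
  rfl

theorem Q_eq_add_div (m : ℕ) {x : ℝ} (hx : 0 < x) : Q (m + 1) x = x + (m + 1) / GR m x := by
  have := Q_ofReal m hx
  rw [Qc, G_ofReal] at this
  exact_mod_cast this

theorem hasDerivAt_Q (m : ℕ) {x : ℝ} (hx : 0 < x) :
    HasDerivAt (Q (m + 1)) (deriv (Q (m + 1)) x) x := by
  have h := (differentiableAt_Qc (m := m) (z := x) (by exact_mod_cast hx.ne')
    (G_ofReal_ne_zero m hx.le)).hasDerivAt.real_of_complex
  refine (h.differentiableAt.congr_of_eventuallyEq ?_).hasDerivAt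
  filter_upwards [lt_mem_nhds hx] with y hy
  rw [← Q_ofReal m hy, Complex.ofReal_re]

theorem hasDerivAt_Qc (m : ℕ) {x : ℝ} (hx : 0 < x) :
    HasDerivAt (Qc m) ((deriv (Q (m + 1)) x : ℝ) : ℂ) x := by
  have h := (differentiableAt_Qc (m := m) (z := x) (by exact_mod_cast hx.ne')
    (G_ofReal_ne_zero m hx.le)).hasDerivAt
  have h1 := (hasDerivAt_Q m hx).ofReal_comp
  have h2 : HasDerivAt (fun y : ℝ => (Q (m + 1) y : ℂ)) (deriv (Qc m) x) x := by
    refine h.comp_ofReal.congr_of_eventuallyEq ?_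
    filter_upwards [lt_mem_nhds hx] with y hy using Q_ofReal m hy
  rw [h1.unique h2]
  exact h

/-- The centred characteristic function of the sum of `q` truncated Poisson variables. -/
noncomputable def charFn (m p q : ℕ) (x θ : ℝ) : ℂ :=
  (Bc (m + 1) (x * Complex.exp (θ * Complex.I)) / Bc (m + 1) x) ^ q *
    Complex.exp (-(p * θ * Complex.I))

theorem continuous_charFn (m p q : ℕ) (x : ℝ) : Continuous (charFn m p q x) := by
  unfold charFn Bc
  fun_prop

theorem charFn_zero (m p q : ℕ) {x : ℝ} (hx : 0 < x) : charFn m p q x 0 = 1 := by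
  have : (B (m + 1) x : ℂ) ≠ 0 := by exact_mod_cast (B_pos m hx).ne'
  simp [charFn, Bc_ofReal, this]

/-- The ratio of the B's and the ratio of the G's differ by e^{i(m+1)t}, of modulus 1. -/
theorem norm_charFn_le (m p q : ℕ) {x t : ℝ} (hx : 0 < x) (ht : |t| ≤ Real.pi) :
    ‖charFn m p q x t‖ ≤ Real.exp (-(1 / ((m + 2) * Real.pi ^ 2) * (q * x) * t ^ 2)) := by
  have hx' : (x : ℂ) ≠ 0 := by exact_mod_cast hx.ne'
  have h1 : Bc (m + 1) (x * Complex.exp (t * Complex.I)) / Bc (m + 1) x =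
      Complex.exp (t * Complex.I) ^ (m + 1) *
        (G m (x * Complex.exp (t * Complex.I)) / G m x) := by
    rw [G_eq_div m hx', G_eq_div m (mul_ne_zero hx' (Complex.exp_ne_zero _)), mul_pow]
    have h2 : (Complex.exp (t * Complex.I)) ^ (m + 1) ≠ 0 := pow_ne_zero _ (Complex.exp_ne_zero _)
    have h3 : ((m + 1).factorial : ℂ) ≠ 0 := by exact_mod_cast (m + 1).factorial_ne_zero
    have h4 : Bc (m + 1) x ≠ 0 := Bc_ne_zero hx' (G_ofReal_ne_zero m hx.le)
    field_simp
  have h2 : ‖Bc (m + 1) (x * Complex.exp (t * Complex.I)) / Bc (m + 1) x‖ ≤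
      Real.exp (-(1 / ((m + 2) * Real.pi ^ 2) * x * t ^ 2)) := by
    have hG := one_le_GR m hx.le
    rw [h1, norm_mul, norm_pow, Complex.norm_exp_ofReal_mul_I, one_pow, one_mul, norm_div,
      G_ofReal, Complex.norm_real, Real.norm_of_nonneg (by linarith), div_le_iff₀ (by linarith),
      mul_comm (Real.exp _)]
    exact norm_G_circle_le m hx.le ht
  rw [charFn, norm_mul, norm_pow]
  have h3 : ‖Complex.exp (-(p * t * Complex.I))‖ = 1 := by
    have : (-(p * t * Complex.I) : ℂ) = ((-(p * t) : ℝ) : ℂ) * Complex.I := by push_cast; ring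
    rw [this, Complex.norm_exp_ofReal_mul_I]
  rw [h3, mul_one]
  refine (pow_le_pow_left₀ (norm_nonneg _) h2 q).trans_eq ?_
  rw [← Real.exp_nat_mul]
  ring_nf

/-- The power contributes iq Q(x e^{iθ}) to the logarithmic derivative, the phase -ip; the saddle
equation p = qQ(x) centres the sum. -/
theorem hasDerivAt_charFn (m p q : ℕ) {x θ : ℝ} (hx : 0 < x)
    (hG : G m (x * Complex.exp (θ * Complex.I)) ≠ 0) (hpq : (p : ℂ) = q * Qc m x) :
    HasDerivAt (charFn m p q x) (Complex.I * q *
      (Qc m (x * Complex.exp (θ * Complex.I)) - Qc m x) * charFn m p q x θ) θ := by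
  have hx' : (x : ℂ) ≠ 0 := by exact_mod_cast hx.ne'
  set w : ℂ → ℂ := fun θ => x * Complex.exp (θ * Complex.I) with hw
  have hw0 : w θ ≠ 0 := mul_ne_zero hx' (Complex.exp_ne_zero _)
  have hwd : HasDerivAt w (Complex.I * w θ) θ := by
    have := (((hasDerivAt_id (θ : ℂ)).mul_const Complex.I).cexp).const_mul (x : ℂ)
    convert! this using 1
    simp [hw]; ring
  have hB0 : Bc (m + 1) (w θ) ≠ 0 := Bc_ne_zero hw0 hG
  have h1 : HasDerivAt (fun θ => Bc (m + 1) (w θ))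
      (Complex.I * Qc m (w θ) * Bc (m + 1) (w θ)) θ := by
    have := (hasDerivAt_Bc m (w θ)).comp (θ : ℂ) hwd
    convert! this using 1
    rw [Qc_eq_div hw0 hG]
    field_simp
  have h2 := (h1.div_const (Bc (m + 1) x)).pow q
  have h3 : HasDerivAt (fun θ : ℂ => Complex.exp (-(p * θ * Complex.I)))
      (Complex.exp (-(p * θ * Complex.I)) * (-(p * Complex.I))) θ := by
    have h4 : HasDerivAt (fun θ : ℂ => -(p * θ * Complex.I)) (-(p * Complex.I)) θ := by
      have := (((hasDerivAt_id (θ : ℂ)).const_mul (p : ℂ)).mul_const Complex.I).neg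
      convert! this using 1
      simp
    exact h4.cexp
  have h5 := (h2.mul h3).comp_ofReal
  convert! h5 using 1
  rw [charFn]
  change Complex.I * q * (Qc m (w θ) - Qc m x) * ((Bc (m + 1) (w θ) / Bc (m + 1) x) ^ q * _) = _
  -- The power rule involves the exponent q - 1; for q = 0 the saddle equation forces p = 0.
  rcases Nat.eq_zero_or_pos q with rfl | hq
  · simp at hpq
    simp [hpq]
  · obtain ⟨k, rfl⟩ : ∃ k, q = k + 1 := ⟨q - 1, by omega⟩
    simp only [Pi.pow_apply]
    rw [hpq, Nat.add_sub_cancel, pow_succ]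
    push_cast
    ring

/-- The saddle point estimate for the integral of the characteristic function. -/
theorem exists_norm_integral_charFn_le (m : ℕ) : ∃ K : ℝ, 0 < K ∧ ∀ (p q : ℕ) (x : ℝ),
    0 < q → 0 < x → Q (m + 1) x = p / q →
    0 < q * x * deriv (Q (m + 1)) x ∧
    ‖((√(q * x * deriv (Q (m + 1)) x / (2 * Real.pi)) : ℝ) : ℂ) *
      (∫ t in (-Real.pi)..Real.pi, charFn m p q x t) - 1‖ ≤ K / (q * x) := by
  obtain ⟨η, C, hη, hη2, hC, hQ⟩ := exists_norm_Qc_sub_le m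
  -- From |e^{iz} - 1| ≤ 2|z|, the disc of radius η/2 in the angle stays inside the disc of radius
  -- ηx about x.
  set ρ := η / 2 with hρ
  have hρ0 : 0 < ρ := by positivity
  set C' := 2 * C / ρ + 4 * C / ρ ^ 2 + 8 * C / ρ ^ 3 with hC'
  have hc1 : 0 ≤ 2 * C / ρ := by positivity
  have hc2 : 0 ≤ 4 * C / ρ ^ 2 := by positivity
  have hc3 : 0 ≤ 8 * C / ρ ^ 3 := by positivity
  -- C' adds the constants for V, b and the Taylor remainder; ρ/2 puts the closed interval inside
  -- the open disc.
  obtain ⟨K, hK, h⟩ := exists_norm_integral_sub_le (C := C') (ρ := ρ / 2)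
    (c := 1 / ((m + 2) * Real.pi ^ 2)) (by positivity) (by positivity) (by linarith)
    (by positivity)
  refine ⟨K, hK, fun p q x hq hx hpq => ?_⟩
  have hq' : (0 : ℝ) < q := by exact_mod_cast hq
  have hpq' : (p : ℂ) = q * Qc m x := by
    rw [← Q_ofReal m hx, hpq]
    have : (q : ℂ) ≠ 0 := by exact_mod_cast hq.ne'
    push_cast
    field_simp
  have hball : ∀ z ∈ ball (0 : ℂ) ρ, ‖x * Complex.exp (z * Complex.I) - x‖ ≤ η * x := by
    intro z hz
    rw [mem_ball_zero_iff] at hz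
    have h1 : ‖z * Complex.I‖ ≤ 1 := by rw [norm_mul, Complex.norm_I]; linarith
    have h2 := Complex.norm_exp_sub_one_le h1
    rw [norm_mul, Complex.norm_I, mul_one] at h2
    have h3 : (x : ℂ) * Complex.exp (z * Complex.I) - x =
        x * (Complex.exp (z * Complex.I) - 1) := by ring
    rw [h3, norm_mul, Complex.norm_real, Real.norm_of_nonneg hx.le, mul_comm]
    gcongr
    linarith
  set F : ℂ → ℂ := fun z => Qc m (x * Complex.exp (z * Complex.I)) - Qc m x with hF
  have hx' : (x : ℂ) ≠ 0 := by exact_mod_cast hx.ne'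
  have hFd : DifferentiableOn ℂ F (ball 0 ρ) := by
    intro z hz
    have h1 : DifferentiableAt ℂ (Qc m) (x * Complex.exp (z * Complex.I)) :=
      differentiableAt_Qc (mul_ne_zero hx' (Complex.exp_ne_zero _)) (hQ x hx _ (hball z hz)).1
    have h2 : DifferentiableAt ℂ (fun z => (x : ℂ) * Complex.exp (z * Complex.I)) z := by fun_prop
    exact ((h1.comp z h2).sub_const _).differentiableWithinAt
  have hF0 : F 0 = 0 := by simp [hF]
  have hFM : ∀ z ∈ ball (0 : ℂ) ρ, ‖F z‖ ≤ 2 * C * x := by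
    intro z hz
    have h1 := (hQ x hx _ (hball z hz)).2
    have h2 := (hQ x hx x (by simp; positivity)).2
    have h3 : F z = (Qc m (x * Complex.exp (z * Complex.I)) - (m + 1)) -
        (Qc m x - (m + 1)) := by simp only [hF]; ring
    rw [h3]
    exact (norm_sub_le _ _).trans (by linarith)
  obtain ⟨hd, b, hb, ht⟩ := exists_norm_taylor_two_le hρ0 hFd hF0 hFM
  have hderiv : deriv F 0 = Complex.I * x * ((deriv (Q (m + 1)) x : ℝ) : ℂ) := by
    have h1 : HasDerivAt (fun z => (x : ℂ) * Complex.exp (z * Complex.I)) (Complex.I * x) 0 := by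
      have := (((hasDerivAt_id (0 : ℂ)).mul_const Complex.I).cexp).const_mul (x : ℂ)
      convert! this using 1
      simp; ring
    have h2 : HasDerivAt (Qc m) ((deriv (Q (m + 1)) x : ℝ) : ℂ)
        ((x : ℂ) * Complex.exp (0 * Complex.I)) := by
      simpa using hasDerivAt_Qc m hx
    have h3 := ((h2.comp 0 h1).sub_const (Qc m x)).deriv
    refine Eq.trans h3 ?_
    ring
  have hmem : ∀ t : ℝ, |t| ≤ ρ / 2 → (t : ℂ) ∈ ball (0 : ℂ) ρ := by
    intro t ht
    rw [mem_ball_zero_iff, Complex.norm_real, Real.norm_eq_abs]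
    linarith
  have hIq : ‖Complex.I * q‖ = q := by rw [norm_mul, Complex.norm_I, one_mul, Complex.norm_natCast]
  refine h (charFn m p q x) (fun t => Complex.I * q * F t) (q * x * deriv (Q (m + 1)) x) (q * x)
    (Complex.I * q * b) (by positivity) (charFn_zero m p q hx) (continuous_charFn m p q x)
    (fun t ht1 => hasDerivAt_charFn m p q hx (hQ x hx _ (hball t (hmem t ht1))).1 hpq')
    (fun t ht1 => ?_) ?_ ?_ (fun t ht1 => norm_charFn_le m p q hx ht1)
  · have h1 : Complex.I * q * F t + ((q * x * deriv (Q (m + 1)) x : ℝ) : ℂ) * t -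
        Complex.I * q * b * t ^ 2 = Complex.I * q * (F t - deriv F 0 * t - b * t ^ 2) := by
      rw [hderiv]
      push_cast
      linear_combination (q * x * ((deriv (Q (m + 1)) x : ℝ) : ℂ) * t) * Complex.I_sq
    have h2 := ht t (hmem t ht1)
    rw [Complex.norm_real, Real.norm_eq_abs] at h2
    rw [h1, norm_mul, hIq]
    calc _ ≤ q * (4 * (2 * C * x) / ρ ^ 3 * |t| ^ 3) := by gcongr
      _ = 8 * C / ρ ^ 3 * (q * x) * |t| ^ 3 := by ring
      _ ≤ _ := by gcongr; linarith
  · rw [norm_mul, hIq]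
    calc _ ≤ q * (2 * (2 * C * x) / ρ ^ 2) := by gcongr
      _ = 4 * C / ρ ^ 2 * (q * x) := by ring
      _ ≤ _ := by gcongr; linarith
  · rw [hderiv, norm_mul, norm_mul, Complex.norm_I, one_mul, Complex.norm_real, Complex.norm_real,
      Real.norm_of_nonneg hx.le, Real.norm_eq_abs] at hd
    have h1 : x * deriv (Q (m + 1)) x ≤ 2 * C * x / ρ :=
      le_trans (mul_le_mul_of_nonneg_left (le_abs_self _) hx.le) hd
    calc _ = q * (x * deriv (Q (m + 1)) x) := by ring
      _ ≤ q * (2 * C * x / ρ) := by gcongr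
      _ = 2 * C / ρ * (q * x) := by ring
      _ ≤ _ := by gcongr; linarith

end AssocStirling

/-! ### Coefficient extraction and comparison with `C` -/

namespace AssocStirling

open Set MeasureTheory

theorem integral_exp_int_mul_I (n p : ℕ) :
    ∫ t in (-Real.pi)..Real.pi, Complex.exp (((n : ℂ) - p) * Complex.I * t) =
      if n = p then 2 * (Real.pi : ℂ) else 0 := by
  split_ifs with h
  · subst h
    simp
    ring
  · have hc : ((n : ℂ) - p) * Complex.I ≠ 0 := by
      refine mul_ne_zero (sub_ne_zero.2 ?_) Complex.I_ne_zero
      exact_mod_cast h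
    rw [integral_exp_mul_complex hc, div_eq_zero_iff, sub_eq_zero]
    left
    rw [Complex.exp_eq_exp_iff_exists_int]
    exact ⟨(n : ℤ) - p, by push_cast; ring⟩

/-- Fourier orthogonality picks out the p-th coefficient; the interchange is dominated by the
coefficients' absolute values. -/
theorem integral_charFn (m p q : ℕ) (x : ℝ) :
    ∫ t in (-Real.pi)..Real.pi, charFn m p q x t =
      2 * Real.pi * ((fiberCount (m + 1) q p : ℂ) / (p.factorial : ℂ) * x ^ p) /
        Bc (m + 1) x ^ q := by
  set a : ℕ → ℂ := fun n => (fiberCount (m + 1) q n : ℂ) / (n.factorial : ℂ) * (x : ℂ) ^ n with ha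
  have hs := (hasSum_fiberCount (m + 1) q x).1
  have key := intervalIntegral.hasSum_integral_of_dominated_convergence (μ := volume)
    (a := -Real.pi) (b := Real.pi)
    (F := fun (n : ℕ) (t : ℝ) => a n * Complex.exp (((n : ℂ) - p) * Complex.I * t))
    (f := fun t : ℝ => Bc (m + 1) (x * Complex.exp (t * Complex.I)) ^ q *
      Complex.exp (-(p * t * Complex.I)))
    (fun n _ => ‖a n‖)
    (fun n => (Continuous.aestronglyMeasurable (by fun_prop)))
    (fun n => Filter.Eventually.of_forall fun t _ => ?_)
    (Filter.Eventually.of_forall fun t _ => hs)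
    intervalIntegrable_const
    (Filter.Eventually.of_forall fun t _ => ?_)
  · simp_rw [intervalIntegral.integral_const_mul, integral_exp_int_mul_I, mul_ite, mul_zero] at key
    have h1 := hasSum_ite_eq p (a p * (2 * (Real.pi : ℂ)))
    have h2 : (fun n => if n = p then a n * (2 * (Real.pi : ℂ)) else 0) =
        fun n => if n = p then a p * (2 * (Real.pi : ℂ)) else 0 := by
      ext n
      split_ifs with h
      · rw [h]
      · rfl
    rw [h2] at key
    have h3 := key.unique h1
    simp_rw [charFn, div_pow, div_mul_eq_mul_div]
    rw [intervalIntegral.integral_div, h3, ha]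
    ring
  · have : ((n : ℂ) - p) * Complex.I * t = (((n - p) * t : ℝ) : ℂ) * Complex.I := by
      push_cast; ring
    rw [norm_mul, this, Complex.norm_exp_ofReal_mul_I, mul_one]
  · have h1 := ((hasSum_fiberCount (m + 1) q (x * Complex.exp (t * Complex.I))).2).mul_right
      (Complex.exp (-(p * t * Complex.I)))
    convert! h1 using 1
    ext n
    rw [ha, mul_pow, ← Complex.exp_nat_mul, ← mul_assoc, mul_assoc _ (Complex.exp _),
      ← Complex.exp_add]
    congr 2
    ring

/-- Since G ≥ 1, x ≤ Q(x) ≤ x + m + 1, so the intermediate value theorem on [y - (m+1), y] gives a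
preimage of y = p/q. Uniqueness plays no role. -/
theorem z0_spec (m : ℕ) {p q : ℕ} (hq : 1 ≤ q) (hpq : (m + 1) * q < p) :
    0 < z0 (m + 1) p q ∧ Q (m + 1) (z0 (m + 1) p q) = p / q := by
  have hq' : (0 : ℝ) < q := by exact_mod_cast hq
  have hy : (m + 1 : ℝ) < p / q := by
    rw [lt_div_iff₀ hq']
    exact_mod_cast hpq
  set y : ℝ := p / q with hy'
  have hm : (0 : ℝ) ≤ m := by positivity
  have hcont : ContinuousOn (Q (m + 1)) (Icc (y - (m + 1)) y) := fun x hx =>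
    (hasDerivAt_Q m (by linarith [hx.1])).continuousAt.continuousWithinAt
  have h1 : Q (m + 1) (y - (m + 1)) ≤ y := by
    have h2 := one_le_GR m (by linarith : 0 ≤ y - (m + 1))
    rw [Q_eq_add_div m (by linarith)]
    have h3 : (m + 1) / GR m (y - (m + 1)) ≤ m + 1 := div_le_self (by linarith) h2
    linarith
  have h2 : y ≤ Q (m + 1) y := by
    have h2 := one_le_GR m (by linarith : 0 ≤ y)
    rw [Q_eq_add_div m (by linarith)]
    have : 0 ≤ (m + 1) / GR m y := by positivity
    linarith
  obtain ⟨x, hx, hxy⟩ := intermediate_value_Icc (by linarith) hcont ⟨h1, h2⟩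
  have hex : ∃ a ∈ Ioi (0 : ℝ), Q (m + 1) a = y := ⟨x, by rw [mem_Ioi]; linarith [hx.1], hxy⟩
  exact ⟨Function.invFunOn_mem hex, Function.invFunOn_eq hex⟩

theorem sub_le_mul_z0 (m : ℕ) {p q : ℕ} (hq : 1 ≤ q) (hpq : (m + 1) * q < p) :
    (p : ℝ) - (m + 1) * q ≤ q * z0 (m + 1) p q := by
  obtain ⟨hx, hQ⟩ := z0_spec m hq hpq
  have hq' : (0 : ℝ) < q := by exact_mod_cast hq
  rw [Q_eq_add_div m hx, eq_div_iff hq'.ne'] at hQ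
  have h1 := one_le_GR m hx.le
  have h2 : (m + 1) / GR m (z0 (m + 1) p q) ≤ m + 1 := div_le_self (by positivity) h1
  nlinarith

/-- Φ' = (qQ - p)/y has a numerator vanishing at the saddle, so only the derivative of the numerator
survives. -/
theorem iteratedDeriv_two_Phi (m : ℕ) {p q : ℕ} {x : ℝ} (hq : 1 ≤ q) (hx : 0 < x)
    (hQ : Q (m + 1) x = p / q) :
    iteratedDeriv 2 (Phi (m + 1) p q) x = q * deriv (Q (m + 1)) x / x := by
  have hq' : (q : ℝ) ≠ 0 := by exact_mod_cast (by omega : q ≠ 0)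
  have h1 : ∀ y, 0 < y → deriv (Phi (m + 1) p q) y = (-p + q * Q (m + 1) y) / y := by
    intro y hy
    have hB := B_pos m hy
    have hd := hasDerivAt_B m y
    have h2 := ((Real.hasDerivAt_log hy.ne').const_mul (-(p : ℝ))).add
      ((hd.log hB.ne').const_mul (q : ℝ))
    refine Eq.trans h2.deriv ?_
    rw [Q, hd.deriv]
    field_simp
  have h3 : deriv (Phi (m + 1) p q) =ᶠ[nhds x] fun y => (-p + q * Q (m + 1) y) / y := by
    filter_upwards [lt_mem_nhds hx] with y hy using h1 y hy
  rw [iteratedDeriv_succ, iteratedDeriv_one, h3.deriv_eq]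
  have h4 := (((hasDerivAt_Q m hx).const_mul (q : ℝ)).const_add (-(p : ℝ))).div
    (hasDerivAt_id x) hx.ne'
  refine Eq.trans h4.deriv ?_
  rw [hQ]
  simp only [id]
  field_simp
  ring

/-- By the formula for Φ'', √((p-rq)/Φ'') = x √((p-rq)/V); then every factor involving p - rq
cancels. -/
theorem C_eq (m : ℕ) {p q : ℕ} (hq : 1 ≤ q) (hpq : (m + 1) * q < p)
    (hV : 0 < q * z0 (m + 1) p q * deriv (Q (m + 1)) (z0 (m + 1) p q)) :
    C (m + 1) p q = (p.factorial : ℝ) / q.factorial *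
      (B (m + 1) (z0 (m + 1) p q) ^ q / z0 (m + 1) p q ^ p) /
        √(2 * Real.pi * (q * z0 (m + 1) p q * deriv (Q (m + 1)) (z0 (m + 1) p q))) := by
  obtain ⟨hx, hQ⟩ := z0_spec m hq hpq
  rw [C, F, iteratedDeriv_two_Phi m hq hx hQ]
  generalize z0 (m + 1) p q = x at *
  set n : ℝ := (p : ℝ) - (m + 1 : ℕ) * q with hn
  have hn0 : 0 < n := by
    rw [hn, sub_pos]
    exact_mod_cast hpq
  set V := q * x * deriv (Q (m + 1)) x with hVdef
  have e1 : n / (q * deriv (Q (m + 1)) x / x) = x ^ 2 * (n / V) := by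
    have : q * deriv (Q (m + 1)) x ≠ 0 := by
      intro h
      rw [hVdef, mul_right_comm, h, zero_mul] at hV
      exact lt_irrefl _ hV
    rw [hVdef, mul_right_comm]
    field_simp
  have e2 : √(x ^ 2 * (n / V)) = x * (√n / √V) := by
    rw [Real.sqrt_mul (by positivity), Real.sqrt_sq hx.le, Real.sqrt_div hn0.le]
  have e3 : √(2 * Real.pi * n) = √(2 * Real.pi) * √n := Real.sqrt_mul (by positivity) _
  have e4 : √(2 * Real.pi * V) = √(2 * Real.pi) * √V := Real.sqrt_mul (by positivity) _
  rw [e1, e2, e3, e4]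
  have h1 : 0 < √n := Real.sqrt_pos.2 hn0
  have h2 : 0 < √V := Real.sqrt_pos.2 hV
  have h3 : 0 < √(2 * Real.pi) := Real.sqrt_pos.2 (by positivity)
  have h4 : 0 < (n / Real.exp 1) ^ (p - (m + 1) * q) := by positivity
  have h5 : ((p - (m + 1) * q).factorial : ℝ) ≠ 0 := by
    exact_mod_cast Nat.factorial_ne_zero _
  have h6 : (q.factorial : ℝ) ≠ 0 := by exact_mod_cast Nat.factorial_ne_zero _
  generalize (n / Real.exp 1) ^ (p - (m + 1) * q) = A at *
  rw [pow_succ]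
  field_simp

/-- S/C equals the normalised integral of `charFn` exactly, so ε inherits its error bound. -/
theorem exists_S_eq_C_mul (m : ℕ) : ∃ K : ℝ, 0 < K ∧ ∀ p q : ℕ, 1 ≤ q → (m + 1) * q < p →
    ∃ ε : ℝ, |ε| ≤ K * ((q : ℝ) * z0 (m + 1) p q)⁻¹ ∧
      (S (m + 1) p q : ℝ) = C (m + 1) p q * (1 + ε) := by
  obtain ⟨K, hK, h⟩ := exists_norm_integral_charFn_le m
  refine ⟨K, hK, fun p q hq hpq => ?_⟩
  obtain ⟨hx, hQ⟩ := z0_spec m hq hpq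
  obtain ⟨hV, hI⟩ := h p q _ hq hx hQ
  have hC := C_eq m hq hpq hV
  rw [integral_charFn, ← factorial_mul_S (by omega), Bc_ofReal] at hI
  generalize z0 (m + 1) p q = x at *
  set V := q * x * deriv (Q (m + 1)) x with hVdef
  have hB := pow_pos (B_pos m hx) q
  have hpi := Real.pi_pos
  have h2 : 0 < √(2 * Real.pi * V) := Real.sqrt_pos.2 (by positivity)
  have hpf : (0 : ℝ) < p.factorial := by exact_mod_cast Nat.factorial_pos _
  have hqf : (0 : ℝ) < q.factorial := by exact_mod_cast Nat.factorial_pos _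
  have hxp := pow_pos hx p
  have hsq : √(V / (2 * Real.pi)) * (2 * Real.pi) = √(2 * Real.pi * V) := by
    have : 2 * Real.pi * V = V / (2 * Real.pi) * (2 * Real.pi) ^ 2 := by field_simp
    rw [this, Real.sqrt_mul (by positivity), Real.sqrt_sq (by positivity)]
  have hC0 : 0 < C (m + 1) p q := by rw [hC]; positivity
  refine ⟨S (m + 1) p q / C (m + 1) p q - 1, ?_, by field_simp; ring⟩
  have h3 : S (m + 1) p q / C (m + 1) p q = √(V / (2 * Real.pi)) * (2 * Real.pi *
      (((q.factorial * S (m + 1) p q : ℕ) : ℝ) / p.factorial * x ^ p) / B (m + 1) x ^ q) := by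
    have hs1 : √(V / (2 * Real.pi)) = √(2 * Real.pi * V) / (2 * Real.pi) := by
      rw [← hsq]; field_simp
    rw [hC, hs1]
    generalize √(2 * Real.pi * V) = T at *
    push_cast
    field_simp
  rw [h3, ← div_eq_mul_inv]
  refine le_trans (le_of_eq ?_) hI
  rw [← Real.norm_eq_abs, ← Complex.norm_real]
  push_cast
  rfl

/-- Stirling's formula with its error term. -/
theorem abs_factorial_div_sub_one_le {n : ℕ} (hn : n ≠ 0) :
    |(n.factorial : ℝ) * (√(2 * Real.pi * n) * (n / Real.exp 1) ^ n)⁻¹ - 1| ≤ 1 / n := by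
  have hn' : (0 : ℝ) < n := by exact_mod_cast Nat.pos_of_ne_zero hn
  have hpi := Real.pi_pos
  set D := √(2 * Real.pi * n) * (n / Real.exp 1) ^ n with hD
  have hD0 : 0 < D := by positivity
  have h1 : 1 ≤ (n.factorial : ℝ) * D⁻¹ := by
    rw [← div_eq_mul_inv, one_le_div hD0]
    exact Stirling.le_factorial_stirling n
  -- The increments of log `stirlingSeq` are bounded by telescoping terms, so this corrected
  -- sequence increases to log √π, and n! exceeds its approximation by at most e^{1/(12n)}.
  have hmono : Monotone fun k : ℕ =>
      Real.log (Stirling.stirlingSeq (k + 1)) - 1 / (12 * ((k : ℝ) + 1)) := by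
    refine monotone_nat_of_le_succ fun k => ?_
    have h2 := Stirling.log_stirlingSeq_sdiff_le (k + 1)
    have h3 : (1 : ℝ) / (12 * (k + 1 : ℕ) * ((k + 1 : ℕ) + 1)) =
        1 / (12 * ((k : ℝ) + 1)) - 1 / (12 * (((k + 1 : ℕ) : ℝ) + 1)) := by
      push_cast
      field_simp
      ring
    rw [h3] at h2
    linarith
  have hlim : Filter.Tendsto (fun k : ℕ =>
      Real.log (Stirling.stirlingSeq (k + 1)) - 1 / (12 * ((k : ℝ) + 1))) Filter.atTop
      (nhds (Real.log (√Real.pi) - 0)) := by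
    refine Filter.Tendsto.sub ?_ ?_
    · exact ((Stirling.tendsto_stirlingSeq_sqrt_pi.comp (Filter.tendsto_add_atTop_nat 1)).log
        (by positivity))
    · have := (tendsto_one_div_add_atTop_nhds_zero_nat (𝕜 := ℝ)).const_mul (1 / 12)
      rw [mul_zero] at this
      refine this.congr fun k => ?_
      field_simp
  obtain ⟨k, rfl⟩ : ∃ k, n = k + 1 := ⟨n - 1, by omega⟩
  have h4 := hmono.ge_of_tendsto hlim k
  have hseq := Stirling.stirlingSeq'_pos k
  have h5 : ((k + 1).factorial : ℝ) * D⁻¹ = Stirling.stirlingSeq (k + 1) / √Real.pi := by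
    rw [Stirling.stirlingSeq, hD, div_div, ← div_eq_mul_inv]
    congr 1
    rw [mul_right_comm (√_), ← Real.sqrt_mul (by positivity)]
    congr 2
    ring
  rw [h5] at h1 ⊢
  have h6 : Stirling.stirlingSeq (k + 1) / √Real.pi ≤ Real.exp (1 / (12 * ((k : ℝ) + 1))) := by
    rw [← Real.log_le_iff_le_exp (by positivity), Real.log_div hseq.ne' (by positivity)]
    linarith
  have h7 : (1 : ℝ) / (12 * ((k : ℝ) + 1)) ≤ 1 := by
    rw [div_le_one (by positivity)]
    linarith [(Nat.cast_nonneg k : (0 : ℝ) ≤ k)]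
  have h8 : (0 : ℝ) ≤ 1 / (12 * ((k : ℝ) + 1)) := by positivity
  have h9 := Real.abs_exp_sub_one_le (x := 1 / (12 * ((k : ℝ) + 1))) (by rwa [abs_of_nonneg h8])
  rw [abs_of_nonneg h8] at h9
  have h10 : 2 * (1 / (12 * ((k : ℝ) + 1))) ≤ 1 / ((k + 1 : ℕ) : ℝ) := by
    push_cast
    rw [mul_one_div, div_le_div_iff₀ (by positivity) (by positivity)]
    linarith [(Nat.cast_nonneg k : (0 : ℝ) ≤ k)]
  rw [abs_of_nonneg (by linarith)]
  linarith [le_abs_self (Real.exp (1 / (12 * ((k : ℝ) + 1))) - 1)]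

end AssocStirling

theorem mainTheorem2 (r : ℕ) (hr : 1 ≤ r) :
    (∃ K M : ℝ, 0 < K ∧ 0 < M ∧ ∀ p q : ℕ, 1 ≤ p → 1 ≤ q → r * q < p →
      M ≤ (q : ℝ) * AssocStirling.z0 r p q →
        ∃ ε : ℝ, |ε| ≤ K * ((q : ℝ) * AssocStirling.z0 r p q)⁻¹ ∧
          (AssocStirling.S r p q : ℝ) = AssocStirling.C r p q * (1 + ε)) ∧
    (∀ δ c : ℝ, 0 < δ → δ < 1 → 0 < c →
      ∃ K : ℝ, 0 < K ∧ ∀ p q : ℕ, 1 ≤ p → 1 ≤ q → r * q < p →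
        c * (p : ℝ) ^ δ ≤ (p : ℝ) - r * q →
          (∃ ε : ℝ, |ε| ≤ K * (p : ℝ) ^ (-δ) ∧
            (AssocStirling.S r p q : ℝ) = AssocStirling.C r p q * (1 + ε)) ∧
          (∃ ε : ℝ, |ε| ≤ K * (p : ℝ) ^ (-δ) ∧
            (AssocStirling.S r p q : ℝ) = AssocStirling.F r p q * (1 + ε))) := by
  obtain ⟨m, rfl⟩ : ∃ m, r = m + 1 := ⟨r - 1, by omega⟩
  obtain ⟨K, hK, h⟩ := AssocStirling.exists_S_eq_C_mul m
  -- The estimate holds without a lower bound on q z₀, so M = 1 is arbitrary.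
  refine ⟨⟨K, 1, hK, one_pos, fun p q _ hq hpq _ => h p q hq hpq⟩, ?_⟩
  intro δ c hδ hδ1 hc
  -- From 1 + ε' = τ(1 + ε): |ε'| ≤ (1 + K)/n + K/n, and 1/n ≤ p^(-δ)/c.
  refine ⟨(1 + 2 * K) / c, by positivity, fun p q hp hq hpq hn => ?_⟩
  obtain ⟨ε, hε, hS⟩ := h p q hq hpq
  have hp' : (0 : ℝ) < p := by exact_mod_cast hp
  have hle := AssocStirling.sub_le_mul_z0 m hq hpq
  have hcast : ((p - (m + 1) * q : ℕ) : ℝ) = (p : ℝ) - (m + 1 : ℕ) * q := by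
    rw [Nat.cast_sub hpq.le]; push_cast; ring
  have hcast' : ((m + 1 : ℕ) : ℝ) = m + 1 := by push_cast; ring
  set n := p - (m + 1) * q with hndef
  have hn0 : n ≠ 0 := by omega
  have hn1 : (1 : ℝ) ≤ n := by exact_mod_cast Nat.pos_of_ne_zero hn0
  rw [← hcast', ← hcast] at hle
  rw [← hcast] at hn
  have hεn : |ε| ≤ K * (1 / n) := by
    refine hε.trans ?_
    rw [one_div]
    gcongr
  have hrate : 1 / (n : ℝ) ≤ 1 / c * (p : ℝ) ^ (-δ) := by
    rw [Real.rpow_neg hp'.le, ← one_div, one_div_mul_one_div]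
    gcongr
  have hpow : 0 < (p : ℝ) ^ (-δ) := Real.rpow_pos_of_pos hp' _
  have hinv : 0 ≤ 1 / (n : ℝ) := by positivity
  have hmul : ∀ L, 0 ≤ L → L * (1 / (n : ℝ)) ≤ L / c * (p : ℝ) ^ (-δ) := fun L hL =>
    (mul_le_mul_of_nonneg_left hrate hL).trans_eq (by ring)
  constructor
  · refine ⟨ε, ?_, hS⟩
    refine le_trans ?_ (hmul (1 + 2 * K) (by positivity))
    nlinarith
  · set τ := (n.factorial : ℝ) * (√(2 * Real.pi * n) * (n / Real.exp 1) ^ n)⁻¹ with hτ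
    have hτ1 : |τ - 1| ≤ 1 / n := AssocStirling.abs_factorial_div_sub_one_le hn0
    have hCF : AssocStirling.C (m + 1) p q = AssocStirling.F (m + 1) p q * τ := by
      rw [AssocStirling.C, ← hcast, ← hndef, hτ]; ring
    refine ⟨(τ - 1) * (1 + ε) + ε, ?_, by rw [hS, hCF]; ring⟩
    refine le_trans ?_ (hmul (1 + 2 * K) (by positivity))
    have h1 : |1 + ε| ≤ 1 + K := by
      have h2 := abs_add_le 1 ε
      rw [abs_one] at h2
      have h3 : 1 / (n : ℝ) ≤ 1 := by rw [div_le_one (by linarith)]; exact hn1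
      nlinarith
    have h4 := abs_add_le ((τ - 1) * (1 + ε)) ε
    rw [abs_mul] at h4
    have h5 : |τ - 1| * |1 + ε| ≤ 1 / n * (1 + K) := by gcongr
    linarith
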